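/- Fix $d\ge 1$. Let $\mathcal R$ be the family of sets $A\subsetneq\mathbb R^d$ that are open, increasing ($\mathbf x\in A$ and $\mathbf a\in[0,\infty)^d$ imply $\mathbf x+\mathbf a\in A$), have convex complement, and satisfy $\mathbf 0\notin\overline A$. For $A\in\mathcal R$ and a probability distribution $F$ on $[0,\infty)^d$, let $F_A$ be the distribution of $Y_A=\sup\{u>0:\mathbf X\in uA\}$ (with $\sup\emptyset=0$), where $\mathbf X\sim F$. Write $F\in\mathcal S_A$ if $F_A$ is subexponential, i.e. its tail $\overline{F_A}(x)=1-F_A(x)$ is positive for all $x\ge 0$ and $\overline{F_A^{2*}}(x)/\overline{F_A}(x)\to 2$ as $x\to\infty$, where $F_A^{2*}$ is the convolution of $F_A$ with itself. Let $A\in\mathcal R$ and let $\mathbf X^{(1)},\mathbf X^{(2)},\dots$ be i.i.d. nonnegative $d$-dimensional random vectors with common distribution $F\in\mathcal S_A$. Let $0<\tau_1<\tau_2<\cdots$ be arrival times with $\tau_n\to\infty$ almost surely whose counting process $N_t=\sup\{n:\tau_n\le t\}$ ($\sup\emptyset=0$) is a Poisson process with rate $\lambda>0$. Let $\{R_t\}_{t\ge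 0}$ be a real stochastic process (the logarithm of the price process), and let $\mathcal G$ be a sub-$\sigma$-algebra of events such that $(t,\omega)\mapsto R_t(\omega)$ is $\mathcal B([0,\infty))\otimes\mathcal G$-measurable (if $R$ has right-continuous paths, one may take $\mathcal G=\sigma(R_s:s\ge 0)$). Assume that the claim sequence $\{\mathbf X^{(i)}\}_{i\ge1}$, the counting process $\{N_t\}_{t\ge 0}$ and $\mathcal G$ are mutually independent. Let $0<T<\infty$ and assume that there are deterministic finite constants $C_1,C_2$ such that, almost surely, $-C_1\le R_t\le C_2$ for all $t\in[0,T]$. Let $\mathbf X$ be a random vector with distribution $F$ that is independent of $\mathcal G$ (for example $\mathbf X=\mathbf X^{(1)}$). Then the discounted total claim vector $\mathbf D(T)=\sum_{i=1}^{N_T}\mathbf X^{(i)}e^{-R_{\tau_i}}$ satisfies $$\mathbb P[\mathbf D(T)\in xA]\sim\lambda\int_0^T\mathbb P\big[\mathbf X e^{-R_t}\in xA\big]\,dt\qquad(x\to\infty),$$ that is, the ratio of the two sides tends to $1$. -/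

import Mathlib

open MeasureTheory ProbabilityTheory Filter Set
open scoped NNReal Topology Pointwise

noncomputable section

/-- The family of sets `A ⊊ ℝ^d` that are open, increasing (`x ∈ A` and `a ≥ 0` componentwise
imply `x + a ∈ A`), have convex complement, and whose closure does not contain the origin. -/
structure IsRiskSet {d : ℕ} (A : Set (Fin d → ℝ)) : Prop where
  ne_univ : A ≠ univ
  isOpen : IsOpen A
  increasing : ∀ x ∈ A, ∀ a : Fin d → ℝ, 0 ≤ a → x + a ∈ A
  convex_compl : Convex ℝ Aᶜ
  zero_notMem_closure : (0 : Fin d → ℝ) ∉ closure A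

/-- The functional `x ↦ sup {u > 0 : x ∈ u A}`, equal to `0` if there is no such `u`.
For `A` in the family above the set is bounded. For vectors `x ≥ 0` no negative `u` is possible,
and `u = 0` would not change the value. -/
def riskFunctional {d : ℕ} (A : Set (Fin d → ℝ)) (x : Fin d → ℝ) : ℝ :=
  sSup {u : ℝ | 0 < u ∧ x ∈ u • A}

/-- The class `𝒮` of subexponential distributions on `[0, ∞)`: all tails are positive, and the
tail of the two-fold convolution is asymptotic to twice the tail. -/
structure IsSubexponential (V : Measure ℝ) : Prop where
  isProbabilityMeasure : IsProbabilityMeasure V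
  nonneg : ∀ᵐ x ∂V, 0 ≤ x
  tail_pos : ∀ x : ℝ, 0 ≤ x → 0 < V.real (Ioi x)
  tendsto_conv : Tendsto (fun x : ℝ => (V ∗ V).real (Ioi x) / V.real (Ioi x)) atTop (𝓝 2)

/-- `F ∈ 𝒮_A`: the law `F_A` of `Y_A = sup {u : X ∈ u A}`, where `X` has law `F`, is
subexponential. -/
def IsSubexponentialOn {d : ℕ} (A : Set (Fin d → ℝ)) (F : Measure (Fin d → ℝ)) : Prop :=
  IsSubexponential (F.map (riskFunctional A))

section Processes

variable {Ω : Type*}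

/-- The number of arrivals up to time `t`, where `τ 0 < τ 1 < ⋯` are the arrival times. -/
def arrivalCount (τ : ℕ → Ω → ℝ≥0) (t : ℝ≥0) (ω : Ω) : ℕ :=
  {i : ℕ | τ i ω ≤ t}.ncard

/-- `τ` is a sequence of arrival times: almost surely `0 < τ 0 < τ 1 < ⋯`, with only finitely
many arrivals in bounded time. -/
structure IsArrivalSequence [MeasurableSpace Ω] (τ : ℕ → Ω → ℝ≥0) (P : Measure Ω) : Prop where
  measurable : ∀ i, Measurable (τ i)
  pos : ∀ᵐ ω ∂P, 0 < τ 0 ω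
  strictMono : ∀ᵐ ω ∂P, StrictMono (fun i => τ i ω)
  tendsto : ∀ᵐ ω ∂P, Tendsto (fun i => τ i ω) atTop atTop

/-- `N` is a (homogeneous) Poisson process with rate `r`: it starts at `0`, is nondecreasing, has
independent increments, and `N t - N s` is Poisson distributed with parameter `r (t - s)`. -/
structure IsPoissonProcess [MeasurableSpace Ω] (r : ℝ≥0) (N : ℝ≥0 → Ω → ℕ)
    (P : Measure Ω) : Prop where
  zero : ∀ᵐ ω ∂P, N 0 ω = 0
  mono : ∀ᵐ ω ∂P, Monotone (fun t => N t ω)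
  indep : HasIndepIncrements N P
  law : ∀ s t : ℝ≥0, s ≤ t →
    HasLaw (fun ω => N t ω - N s ω) (poissonMeasure (r * (t - s))) P

/-- `R` is a measurable process, jointly in time and scenario, with respect to the σ-algebra `𝓖`
of scenarios. For instance, a process with right-continuous paths is measurable with respect to
the σ-algebra that it generates. -/
def IsMeasurableProcess (𝓖 : MeasurableSpace Ω) (R : ℝ≥0 → Ω → ℝ) : Prop :=
  Measurable[MeasurableSpace.prod inferInstance 𝓖] (fun p : ℝ≥0 × Ω => R p.1 p.2)

/-- The discounted total claims `D(t) = ∑_{i ≤ N_t} X^{(i)} exp (-R_{τ_i})`. -/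
def discountedClaims {d : ℕ} (X : ℕ → Ω → Fin d → ℝ) (τ : ℕ → Ω → ℝ≥0) (R : ℝ≥0 → Ω → ℝ)
    (t : ℝ≥0) (ω : Ω) : Fin d → ℝ :=
  ∑ i ∈ Finset.range (arrivalCount τ t ω), Real.exp (-R (τ i ω) ω) • X i ω

end Processes

end

/-! The complement of $A$ is a closed convex neighbourhood of $0$, so $Y_A$ is its gauge and
$\mathbf X\in xA$ means $Y_A>x$. The gauge is sublinear and, since $A$ is increasing, monotone. For
nonnegative claims and weights $c_i$, the event $\sum c_i\mathbf X^{(i)}\in xA$ therefore contains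
$\{\max c_iY_i>x\}$ and is contained in $\{\sum c_iY_i>x\}$, where the $Y_i$ are i.i.d. real
subexponential variables.

By the principle of one big jump, both bounds are asymptotic to $\sum_i\overline{F_A}(x/c_i)$,
uniformly for weights in a compact $[a,b]\subset(0,\infty)$ (`exists_weightedSum_tail_le`,
`exists_le_weightedMax_tail`).

Independence allows the arrival times and the price to be frozen, and $e^{-R}$ stays in such an
interval. On $\{N_T=m+1\}$ the summed intensity of the arrivals is $\lambda\,\mathbb P[N_T=m]\,dt$
on $(0,T]$ (`sum_map_arrival`), so this event contributes $\mathbb P[N_T=m]$ to the limit of the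
ratio, and these numbers sum to $1$. The limit and the sum over $m$ are interchanged by dominated
convergence: the geometric bound $K^n$ of `weightedSum_tail_le` is summable against Poisson weights.
-/

open scoped ENNReal

/-! ### The risk functional as a gauge -/

namespace IsRiskSet

variable {d : ℕ} {A : Set (Fin d → ℝ)}

theorem compl_mem_nhds_zero (hA : IsRiskSet A) : Aᶜ ∈ 𝓝 (0 : Fin d → ℝ) :=
  Filter.mem_of_superset (isClosed_closure.isOpen_compl.mem_nhds hA.zero_notMem_closure)
    (compl_subset_compl.2 subset_closure)

/-- A closed convex neighbourhood of the origin is the closed unit ball of its gauge. -/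
theorem mem_iff_one_lt_gauge (hA : IsRiskSet A) (x : Fin d → ℝ) : x ∈ A ↔ 1 < gauge Aᶜ x := by
  have h := gauge_le_one_iff_mem_closure (x := x) hA.convex_compl hA.compl_mem_nhds_zero
  rw [hA.isOpen.isClosed_compl.closure_eq, mem_compl_iff] at h
  rw [← not_iff_not, ← h, not_lt]

theorem mem_smul_iff_lt_gauge (hA : IsRiskSet A) {u : ℝ} (hu : 0 < u) (x : Fin d → ℝ) :
    x ∈ u • A ↔ u < gauge Aᶜ x := by
  rw [mem_smul_set_iff_inv_smul_mem₀ hu.ne', hA.mem_iff_one_lt_gauge,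
    gauge_smul_of_nonneg (inv_nonneg.2 hu.le), smul_eq_mul, inv_mul_eq_div, one_lt_div hu]

theorem riskFunctional_eq_gauge (hA : IsRiskSet A) (x : Fin d → ℝ) :
    riskFunctional A x = gauge Aᶜ x := by
  have h : {u : ℝ | 0 < u ∧ x ∈ u • A} = Ioo 0 (gauge Aᶜ x) := by
    ext u
    exact and_congr_right fun hu => hA.mem_smul_iff_lt_gauge hu x
  rw [riskFunctional, h]
  -- If the gauge vanishes, the set of admissible `u` is empty and the convention `sSup ∅ = 0` gives
  -- the right value.
  rcases (gauge_nonneg (s := Aᶜ) x).eq_or_lt with h0 | h0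
  · simp [← h0]
  · exact csSup_Ioo h0

theorem mem_smul_iff (hA : IsRiskSet A) {u : ℝ} (hu : 0 < u) (x : Fin d → ℝ) :
    x ∈ u • A ↔ u < riskFunctional A x := by
  rw [hA.riskFunctional_eq_gauge, hA.mem_smul_iff_lt_gauge hu]

theorem riskFunctional_nonneg (hA : IsRiskSet A) (x : Fin d → ℝ) : 0 ≤ riskFunctional A x := by
  rw [hA.riskFunctional_eq_gauge]
  exact gauge_nonneg x

theorem riskFunctional_smul (hA : IsRiskSet A) {c : ℝ} (hc : 0 ≤ c) (x : Fin d → ℝ) :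
    riskFunctional A (c • x) = c * riskFunctional A x := by
  rw [hA.riskFunctional_eq_gauge, hA.riskFunctional_eq_gauge, gauge_smul_of_nonneg hc, smul_eq_mul]

/-- Convexity of the complement enters here; this gives the upper bound by a sum of real variables.
-/
theorem riskFunctional_sum_le (hA : IsRiskSet A) {ι : Type*} (s : Finset ι)
    (x : ι → Fin d → ℝ) :
    riskFunctional A (∑ i ∈ s, x i) ≤ ∑ i ∈ s, riskFunctional A (x i) := by
  simp only [hA.riskFunctional_eq_gauge]
  exact gauge_sum_le hA.convex_compl (absorbent_nhds_zero hA.compl_mem_nhds_zero) s x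

/-- Here `A` being increasing is used; it makes one large claim among nonnegative ones sufficient,
which gives the lower bound. -/
theorem riskFunctional_mono (hA : IsRiskSet A) {x y : Fin d → ℝ} (hxy : x ≤ y) :
    riskFunctional A x ≤ riskFunctional A y := by
  refine le_of_forall_lt_imp_le_of_dense fun u hu => ?_
  rcases le_or_gt u 0 with h0 | h0
  · exact h0.trans (hA.riskFunctional_nonneg y)
  · rw [← hA.mem_smul_iff h0, mem_smul_set_iff_inv_smul_mem₀ h0.ne'] at hu
    have h := hA.increasing _ hu (u⁻¹ • (y - x))
      (smul_nonneg (inv_nonneg.2 h0.le) (sub_nonneg.2 hxy))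
    rw [← smul_add, add_sub_cancel, ← mem_smul_set_iff_inv_smul_mem₀ h0.ne',
      hA.mem_smul_iff h0] at h
    exact h.le

theorem measurable_riskFunctional (hA : IsRiskSet A) : Measurable (riskFunctional A) := by
  rw [funext hA.riskFunctional_eq_gauge]
  exact (continuous_gauge hA.convex_compl hA.compl_mem_nhds_zero).measurable

end IsRiskSet

/-! ### Tail estimates for subexponential laws -/

theorem measureReal_conv_Ioi (V : Measure ℝ) (x : ℝ) :
    (V ∗ V).real (Ioi x) = (V.prod V).real {p : ℝ × ℝ | x < p.1 + p.2} := by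
  rw [Measure.conv, map_measureReal_apply (by fun_prop) measurableSet_Ioi]
  rfl

namespace IsSubexponential

variable {V : Measure ℝ}

theorem ae_nonneg_prod (hV : IsSubexponential V) :
    ∀ᵐ p ∂(V.prod V), 0 ≤ p.1 ∧ 0 ≤ p.2 := by
  have := hV.isProbabilityMeasure
  exact (Measure.quasiMeasurePreserving_fst.ae hV.nonneg).and
    (Measure.quasiMeasurePreserving_snd.ae hV.nonneg)

theorem measureReal_Ioi_pos (hV : IsSubexponential V) (x : ℝ) : 0 < V.real (Ioi x) := by
  have := hV.isProbabilityMeasure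
  rcases le_total 0 x with h | h
  · exact hV.tail_pos x h
  · exact (hV.tail_pos 0 le_rfl).trans_le (measureReal_mono (Ioi_subset_Ioi h))

theorem measureReal_Ioi_of_neg (hV : IsSubexponential V) {x : ℝ} (hx : x < 0) :
    V.real (Ioi x) = 1 := by
  have := hV.isProbabilityMeasure
  rw [← probReal_univ (μ := V)]
  refine measureReal_congr (hV.nonneg.mono fun y hy => ?_)
  exact propext (iff_of_true (hx.trans_le hy) trivial)

/-- For nonnegative `u`, `v`, three disjoint rectangles force `u + v > x`: `u > x`; `u ≤ y` with `v
> x`; `y < u ≤ x` with `v > x - y`. -/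
theorem tail_bound_conv (hV : IsSubexponential V) {x y : ℝ} (hyx : y ≤ x) :
    V.real (Ioi x) + V.real (Iic y) * V.real (Ioi x) + V.real (Ioc y x) * V.real (Ioi (x - y)) ≤
      (V ∗ V).real (Ioi x) := by
  have := hV.isProbabilityMeasure
  have h1 : (V.prod V).real (Ioi x ×ˢ univ ∪ Iic y ×ˢ Ioi x ∪ Ioc y x ×ˢ Ioi (x - y)) =
      V.real (Ioi x) + V.real (Iic y) * V.real (Ioi x) +
        V.real (Ioc y x) * V.real (Ioi (x - y)) := by
    rw [measureReal_union, measureReal_union, measureReal_prod_prod, measureReal_prod_prod,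
      measureReal_prod_prod, probReal_univ, mul_one]
    · rw [Set.disjoint_left]
      rintro ⟨u, v⟩ ⟨h, -⟩ ⟨h', -⟩
      simp only [mem_Ioi, mem_Iic] at h h'
      linarith
    · exact measurableSet_Iic.prod measurableSet_Ioi
    · rw [Set.disjoint_left]
      rintro ⟨u, v⟩ (⟨h, -⟩ | ⟨h, -⟩) ⟨h', -⟩ <;>
      · simp only [mem_Ioi, mem_Iic, mem_Ioc] at h h'
        linarith
    · exact measurableSet_Ioc.prod measurableSet_Ioi
  rw [← h1, measureReal_conv_Ioi]
  refine ENNReal.toReal_mono (measure_ne_top _ _) (measure_mono_ae ?_)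
  filter_upwards [hV.ae_nonneg_prod] with p hp h
  change x < p.1 + p.2
  rcases h with (⟨h, h'⟩ | ⟨h, h'⟩) | ⟨h, h'⟩ <;> simp only [mem_Ioi, mem_Iic, mem_Ioc] at h h' <;>
    linarith

theorem tendsto_Ioi_atTop [IsFiniteMeasure V] : Tendsto (fun x => V.real (Ioi x)) atTop (𝓝 0) := by
  have h := tendsto_measure_iInter_atTop (μ := V) (s := fun x : ℝ => Ioi x)
    (fun _ => measurableSet_Ioi.nullMeasurableSet) (fun _ _ h => Ioi_subset_Ioi h)
    ⟨0, measure_ne_top _ _⟩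
  have h0 : ⋂ x : ℝ, Ioi x = ∅ := by
    ext y
    simpa using ⟨y, le_rfl⟩
  rw [h0, measure_empty] at h
  exact (ENNReal.tendsto_toReal ENNReal.zero_ne_top).comp h

theorem measureReal_Ioc_eq [IsFiniteMeasure V] {x y : ℝ} (hyx : y ≤ x) :
    V.real (Ioc y x) = V.real (Ioi y) - V.real (Ioi x) := by
  rw [← Ioi_sdiff_Ioi, measureReal_sdiff (Ioi_subset_Ioi hyx) measurableSet_Ioi]

theorem measureReal_Iic_eq [IsProbabilityMeasure V] (y : ℝ) :
    V.real (Iic y) = 1 - V.real (Ioi y) := by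
  rw [← probReal_compl_eq_one_sub measurableSet_Ioi, compl_Ioi]

/-- Subexponential distributions are long-tailed. -/
theorem tendsto_tail_sub_div (hV : IsSubexponential V) {y : ℝ} (hy : 0 ≤ y) :
    Tendsto (fun x : ℝ => V.real (Ioi (x - y)) / V.real (Ioi x)) atTop (𝓝 1) := by
  have := hV.isProbabilityMeasure
  have hpos := hV.measureReal_Ioi_pos
  have hd : Tendsto (fun x => V.real (Ioi y) - V.real (Ioi x)) atTop (𝓝 (V.real (Ioi y))) := by
    simpa using (tendsto_const_nhds (x := V.real (Ioi y))).sub (tendsto_Ioi_atTop (V := V))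
  -- Upper bound obtained by solving `tail_bound_conv` for the ratio; it tends to `(2 - 1 - V(Iic
  -- y)) / V(Ioi y) = 1`.
  have hup : Tendsto (fun x => ((V ∗ V).real (Ioi x) / V.real (Ioi x) - 1 - V.real (Iic y)) /
      (V.real (Ioi y) - V.real (Ioi x))) atTop (𝓝 1) := by
    have h := ((hV.tendsto_conv.sub_const 1).sub_const (V.real (Iic y))).div hd (hpos y).ne'
    rwa [measureReal_Iic_eq, show (2 - 1 - (1 - V.real (Ioi y))) / V.real (Ioi y) = (1 : ℝ) by
      rw [div_eq_one_iff_eq (hpos y).ne']; ring, ← measureReal_Iic_eq] at h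
  refine tendsto_of_tendsto_of_tendsto_of_le_of_le' tendsto_const_nhds hup ?_ ?_
  · filter_upwards with x
    rw [one_le_div (hpos x)]
    exact measureReal_mono (Ioi_subset_Ioi (by linarith))
  · filter_upwards [eventually_ge_atTop y, hd.eventually (lt_mem_nhds (hpos y))] with x hx hx'
    have h := hV.tail_bound_conv hx
    rw [measureReal_Ioc_eq hx] at h
    have hx0 := hpos x
    rw [le_div_iff₀ hx', div_sub' hx0.ne', div_sub' hx0.ne', div_mul_eq_mul_div,
      div_le_div_iff_of_pos_right hx0]
    linarith

/-- Besides the joint event, `u + v > z` almost surely contains the two rectangles where one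
coordinate exceeds `z` and the other is at most `h`; `h ≤ z` makes the three disjoint. -/
theorem joint_tail_le (hV : IsSubexponential V) {h z : ℝ} (hz : h ≤ z) :
    (V.prod V).real {p : ℝ × ℝ | h < p.1 ∧ h < p.2 ∧ z < p.1 + p.2} ≤
      (V ∗ V).real (Ioi z) - 2 * V.real (Iic h) * V.real (Ioi z) := by
  have := hV.isProbabilityMeasure
  set B := {p : ℝ × ℝ | h < p.1 ∧ h < p.2 ∧ z < p.1 + p.2} with hB
  have h1 : (V.prod V).real (B ∪ Iic h ×ˢ Ioi z ∪ Ioi z ×ˢ Iic h) =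
      (V.prod V).real B + V.real (Iic h) * V.real (Ioi z) + V.real (Ioi z) * V.real (Iic h) := by
    rw [measureReal_union, measureReal_union, measureReal_prod_prod, measureReal_prod_prod]
    · rw [Set.disjoint_left]
      rintro ⟨u, v⟩ ⟨h, -⟩ ⟨h', -⟩
      simp only [mem_Iic] at h h'
      linarith
    · exact measurableSet_Iic.prod measurableSet_Ioi
    · rw [Set.disjoint_left]
      rintro ⟨u, v⟩ (⟨h, h1, -⟩ | ⟨h, -⟩) ⟨h', h2⟩ <;>
      · simp only [mem_Ioi, mem_Iic] at h h' h2
        linarith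
    · exact measurableSet_Ioi.prod measurableSet_Iic
  suffices (V.prod V).real (B ∪ Iic h ×ˢ Ioi z ∪ Ioi z ×ˢ Iic h) ≤ (V ∗ V).real (Ioi z) by
    rw [h1] at this
    linarith
  rw [measureReal_conv_Ioi]
  refine ENNReal.toReal_mono (measure_ne_top _ _) (measure_mono_ae ?_)
  filter_upwards [hV.ae_nonneg_prod] with p hp h
  change z < p.1 + p.2
  rcases h with (h | ⟨h, h'⟩) | ⟨h, h'⟩
  · exact h.2.2
  · simp only [mem_Ioi, mem_Iic] at h h'
    linarith
  · simp only [mem_Ioi, mem_Iic] at h h'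
    linarith

theorem exists_joint_tail_le (hV : IsSubexponential V) {δ : ℝ} (hδ : 0 < δ) :
    ∃ h₀ : ℝ, 0 ≤ h₀ ∧ ∀ h ≥ h₀, ∃ z₀ : ℝ, ∀ z ≥ z₀,
      (V.prod V).real {p : ℝ × ℝ | h < p.1 ∧ h < p.2 ∧ z < p.1 + p.2} ≤ δ * V.real (Ioi z) := by
  have := hV.isProbabilityMeasure
  -- The two tolerances combine to `(2 + δ/2) - 2 (1 - δ/4) = δ`.
  obtain ⟨h₁, hh₁⟩ := eventually_atTop.1
    ((tendsto_Ioi_atTop (V := V)).eventually (gt_mem_nhds (show 0 < δ / 4 by positivity)))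
  refine ⟨max h₁ 0, le_max_right _ _, fun h hh => ?_⟩
  obtain ⟨z₁, hz₁⟩ := eventually_atTop.1
    (hV.tendsto_conv.eventually (gt_mem_nhds (show (2 : ℝ) < 2 + δ / 2 by linarith)))
  refine ⟨max z₁ h, fun z hz => (hV.joint_tail_le (le_of_max_le_right hz)).trans ?_⟩
  have h1 := hh₁ h (le_of_max_le_left hh)
  have h2 := hz₁ z (le_of_max_le_left hz)
  have hz0 := hV.measureReal_Ioi_pos z
  rw [div_lt_iff₀ hz0] at h2
  rw [measureReal_Iic_eq]
  nlinarith

/-- Two weighted claims are simultaneously large, and have a large sum, with a probability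
negligible with respect to the sum of the tails, uniformly in the weights. -/
theorem exists_weighted_joint_tail_le (hV : IsSubexponential V) {a b : ℝ} (ha : 0 < a)
    {δ : ℝ} (hδ : 0 < δ) :
    ∃ h₀ : ℝ, 0 ≤ h₀ ∧ ∀ h ≥ h₀, ∃ x₀ : ℝ, ∀ x ≥ x₀, ∀ c ∈ Icc a b, ∀ c' ∈ Icc a b,
      (V.prod V).real {p : ℝ × ℝ | h < c * p.1 ∧ h < c' * p.2 ∧ x < c * p.1 + c' * p.2} ≤
        δ * (V.real (Ioi (x / c)) + V.real (Ioi (x / c'))) := by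
  have := hV.isProbabilityMeasure
  obtain ⟨h₀, hh₀, H⟩ := hV.exists_joint_tail_le hδ
  rcases le_or_gt a b with hab | hab
  swap
  · exact ⟨0, le_rfl, fun h _ => ⟨0, fun x _ c hc => absurd (hc.1.trans hc.2) hab.not_ge⟩⟩
  have hb : 0 < b := ha.trans_le hab
  refine ⟨h₀ * b, by positivity, fun h hh => ?_⟩
  obtain ⟨z₀, hz₀⟩ := H (h / b) ((le_div_iff₀ hb).2 hh)
  have hh0 : 0 ≤ h := (by positivity : (0 : ℝ) ≤ h₀ * b).trans hh
  refine ⟨max z₀ 0 * b, fun x hx c hc c' hc' => ?_⟩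
  have hc0 : 0 < c := ha.trans_le hc.1
  have hc0' : 0 < c' := ha.trans_le hc'.1
  -- Replacing both weights by the larger one in the sum, and by `b` in the separate conditions,
  -- reduces to the unweighted estimate at level `x / m`, whose tail is one of the two on the right.
  set m := max c c' with hm
  have hm0 : 0 < m := hc0.trans_le (le_max_left _ _)
  have hmb : m ≤ b := max_le hc.2 hc'.2
  have hz : z₀ ≤ x / m := by
    rw [le_div_iff₀ hm0]
    refine le_trans ?_ hx
    exact mul_le_mul (le_max_left _ _) hmb hm0.le (le_max_right _ _)
  calc (V.prod V).real {p : ℝ × ℝ | h < c * p.1 ∧ h < c' * p.2 ∧ x < c * p.1 + c' * p.2}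
      ≤ (V.prod V).real {p : ℝ × ℝ | h / b < p.1 ∧ h / b < p.2 ∧ x / m < p.1 + p.2} := by
        refine measureReal_mono ?_
        rintro ⟨u, v⟩ ⟨h1, h2, h3⟩
        simp only at h1 h2 h3
        have hu : 0 < u := pos_of_mul_pos_right (hh0.trans_lt h1) hc0.le
        have hv : 0 < v := pos_of_mul_pos_right (hh0.trans_lt h2) hc0'.le
        refine ⟨?_, ?_, ?_⟩ <;> simp only
        · rw [div_lt_iff₀' hb]
          exact h1.trans_le (mul_le_mul_of_nonneg_right hc.2 hu.le)
        · rw [div_lt_iff₀' hb]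
          exact h2.trans_le (mul_le_mul_of_nonneg_right hc'.2 hv.le)
        · rw [div_lt_iff₀' hm0, mul_add]
          exact h3.trans_le (add_le_add (mul_le_mul_of_nonneg_right (le_max_left _ _) hu.le)
            (mul_le_mul_of_nonneg_right (le_max_right _ _) hv.le))
    _ ≤ δ * V.real (Ioi (x / m)) := hz₀ _ hz
    _ ≤ δ * (V.real (Ioi (x / c)) + V.real (Ioi (x / c'))) := by
        gcongr
        rcases max_choice c c' with h | h <;> rw [hm, h]
        · exact le_add_of_nonneg_right measureReal_nonneg
        · exact le_add_of_nonneg_left measureReal_nonneg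

/-- Uniform because the shift `h / c` is at most the fixed shift `h / a`, while `x / c ≥ x / b` for
`x ≥ 0`. -/
theorem exists_weighted_tail_sub_le (hV : IsSubexponential V) {a b : ℝ} (ha : 0 < a)
    {ε h : ℝ} (hε : 0 < ε) (hh : 0 ≤ h) :
    ∃ x₀ : ℝ, ∀ x ≥ x₀, ∀ c ∈ Icc a b,
      V.real (Ioi ((x - h) / c)) ≤ (1 + ε) * V.real (Ioi (x / c)) := by
  have := hV.isProbabilityMeasure
  obtain ⟨z₀, hz₀⟩ := eventually_atTop.1
    ((hV.tendsto_tail_sub_div (div_nonneg hh ha.le)).eventually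
      (gt_mem_nhds (show (1 : ℝ) < 1 + ε by linarith)))
  refine ⟨max z₀ 0 * b, fun x hx c hc => ?_⟩
  have hc0 : 0 < c := ha.trans_le hc.1
  have hz : z₀ ≤ x / c := by
    rw [le_div_iff₀ hc0]
    exact (mul_le_mul (le_max_left _ _) hc.2 hc0.le (le_max_right _ _)).trans hx
  have h1 := hz₀ _ hz
  rw [div_lt_iff₀ (hV.measureReal_Ioi_pos _)] at h1
  refine le_trans (measureReal_mono (Ioi_subset_Ioi ?_)) h1.le
  rw [sub_div]
  gcongr
  exact hc.1

/-- The tail of the convolution is dominated by a multiple of the tail. -/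
theorem exists_conv_le (hV : IsSubexponential V) :
    ∃ K : ℝ, 1 ≤ K ∧ ∀ x, (V ∗ V).real (Ioi x) ≤ K * V.real (Ioi x) := by
  have := hV.isProbabilityMeasure
  obtain ⟨z₀, hz₀⟩ := eventually_atTop.1
    (hV.tendsto_conv.eventually (gt_mem_nhds (show (2 : ℝ) < 3 by norm_num)))
  have hp := hV.measureReal_Ioi_pos z₀
  -- The value `3` serves beyond `z₀`; below it, the trivial bound `1` is compared with the tail at
  -- `z₀`.
  refine ⟨max 3 (1 / V.real (Ioi z₀)), le_max_of_le_left (by norm_num), fun x => ?_⟩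
  have hx := hV.measureReal_Ioi_pos x
  rcases le_total z₀ x with h | h
  · have h1 := hz₀ x h
    rw [div_lt_iff₀ hx] at h1
    exact h1.le.trans (mul_le_mul_of_nonneg_right (le_max_left _ _) hx.le)
  · calc (V ∗ V).real (Ioi x) ≤ 1 := measureReal_le_one
      _ = 1 / V.real (Ioi z₀) * V.real (Ioi z₀) := by rw [one_div_mul_cancel hp.ne']
      _ ≤ max 3 (1 / V.real (Ioi z₀)) * V.real (Ioi x) := by
        gcongr
        · exact le_max_right _ _
        · exact measure_ne_top _ _

end IsSubexponential

/-! ### Weighted sums of independent subexponential variables -/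

theorem measureReal_prod_eq_integral (μ κ : Measure ℝ) [IsFiniteMeasure μ] [IsFiniteMeasure κ]
    {S : Set (ℝ × ℝ)} (hS : MeasurableSet S) :
    Integrable (fun y => μ.real ((fun u => (u, y)) ⁻¹' S)) κ ∧
      (μ.prod κ).real S = ∫ y, μ.real ((fun u => (u, y)) ⁻¹' S) ∂κ := by
  have hm : Measurable fun y => μ ((fun u => (u, y)) ⁻¹' S) := measurable_measure_prodMk_right hS
  refine ⟨?_, ?_⟩
  · refine Integrable.of_bound hm.ennreal_toReal.aestronglyMeasurable (μ.real univ)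
      (ae_of_all _ fun y => ?_)
    rw [Real.norm_of_nonneg measureReal_nonneg]
    exact measureReal_mono (subset_univ _)
  · simp only [measureReal_def]
    rw [integral_toReal hm.aemeasurable (ae_of_all _ fun y => measure_lt_top _ _),
      Measure.prod_apply_symm hS]

/-- Integration of the slice bound over `κ`. In the inductions, `μ` is the law of a partial sum and
the `ν i` are laws of single terms. -/
theorem measureReal_prod_le {μ κ : Measure ℝ} [IsFiniteMeasure μ] [IsFiniteMeasure κ] {ι : Type*}
    (s : Finset ι) (ν : ι → Measure ℝ) [∀ i, IsFiniteMeasure (ν i)] (C : ℝ) {S : Set (ℝ × ℝ)}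
    (hS : MeasurableSet S)
    (h : ∀ y, μ.real ((fun u => (u, y)) ⁻¹' S) ≤
      C * ∑ i ∈ s, (ν i).real ((fun u => (u, y)) ⁻¹' S)) :
    (μ.prod κ).real S ≤ C * ∑ i ∈ s, ((ν i).prod κ).real S := by
  have h1 : ∀ i ∈ s, Integrable (fun y => (ν i).real ((fun u => (u, y)) ⁻¹' S)) κ :=
    fun i _ => (measureReal_prod_eq_integral (ν i) κ hS).1
  simp only [fun i => (measureReal_prod_eq_integral (ν i) κ hS).2,
    (measureReal_prod_eq_integral μ κ hS).2]
  rw [← integral_finsetSum s h1, ← integral_const_mul]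
  exact integral_mono (measureReal_prod_eq_integral μ κ hS).1
    ((integrable_finsetSum s h1).const_mul C) h

section WeightedSums

variable {Ω : Type*} [MeasurableSpace Ω] {P : Measure Ω} {V : Measure ℝ} {Y : ℕ → Ω → ℝ}

theorem indepFun_weightedSum (hY : ∀ i, Measurable (Y i))
    (hind : iIndepFun Y P) (c : ℕ → ℝ) (n : ℕ) :
    IndepFun (fun ω => ∑ i ∈ Finset.range n, c i * Y i ω) (fun ω => c n * Y n ω) P := by
  have h : iIndepFun (fun i ω => c i * Y i ω) P :=
    hind.comp (fun i x => c i * x) fun i => measurable_const_mul _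
  have h2 := h.indepFun_finsetSum_of_notMem (fun i => (hY i).const_mul _)
    (Finset.notMem_range_self (n := n))
  convert h2 using 1
  ext ω
  simp

theorem measurable_weightedSum (hY : ∀ i, Measurable (Y i)) (c : ℕ → ℝ) (n : ℕ) :
    Measurable (fun ω => ∑ i ∈ Finset.range n, c i * Y i ω) :=
  Finset.measurable_sum _ fun i _ => (hY i).const_mul _

theorem measureReal_weighted_pair (hY : ∀ i, Measurable (Y i)) [IsProbabilityMeasure P]
    (hind : iIndepFun Y P) (c : ℕ → ℝ) (n : ℕ) {S : Set (ℝ × ℝ)} (hS : MeasurableSet S) :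
    P.real {ω | (∑ i ∈ Finset.range n, c i * Y i ω, c n * Y n ω) ∈ S} =
      ((P.map fun ω => ∑ i ∈ Finset.range n, c i * Y i ω).prod
        (P.map fun ω => c n * Y n ω)).real S := by
  have hm := measurable_weightedSum hY c n
  have hn : Measurable fun ω => c n * Y n ω := (hY n).const_mul _
  rw [← (indepFun_iff_map_prod_eq_prod_map_map hm.aemeasurable hn.aemeasurable).1
    (indepFun_weightedSum hY hind c n), map_measureReal_apply (hm.prodMk hn) hS]
  rfl

theorem map_weighted_eq (hY : ∀ i, Measurable (Y i)) (hlaw : ∀ i, HasLaw (Y i) V P) (c : ℝ)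
    (i : ℕ) : (P.map fun ω => c * Y i ω) = V.map (c * ·) := by
  rw [← (hlaw i).map_eq, Measure.map_map (measurable_const_mul c) (hY i)]
  rfl

theorem measureReal_weighted_gt [IsProbabilityMeasure P] (hlaw : ∀ i, HasLaw (Y i) V P) {c : ℝ}
    (hc : 0 < c) (i : ℕ) (x : ℝ) : P.real {ω | x < c * Y i ω} = V.real (Ioi (x / c)) := by
  have h := (hlaw i).measureReal_eq (p := fun y => x / c < y) measurableSet_Ioi
  simp only [div_lt_iff₀' hc] at h
  rw [h]
  congr 1
  ext y
  exact (div_lt_iff₀' hc).symm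

/-- Conditioning on the last summand costs one factor `K`. The induction hypothesis is used at every
level `u - y`, possibly negative, hence the quantifier over all real `u`. -/
theorem IsSubexponential.sum_tail_le [IsProbabilityMeasure P] (hV : IsSubexponential V) {K : ℝ}
    (hK : 1 ≤ K) (hconv : ∀ x, (V ∗ V).real (Ioi x) ≤ K * V.real (Ioi x))
    (hY : ∀ i, Measurable (Y i)) (hlaw : ∀ i, HasLaw (Y i) V P) (hind : iIndepFun Y P) (n : ℕ) :
    ∀ u : ℝ, P.real {ω | u < ∑ i ∈ Finset.range n, Y i ω} ≤ K ^ n * V.real (Ioi u) := by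
  have := hV.isProbabilityMeasure
  induction n with
  | zero =>
    intro u
    rcases lt_or_ge u 0 with h | h
    · simp [hV.measureReal_Ioi_of_neg h]
    · simp [h.not_gt]
  | succ n ih =>
    intro u
    have hS : MeasurableSet {p : ℝ × ℝ | u < p.1 + p.2} :=
      measurableSet_lt measurable_const (measurable_fst.add measurable_snd)
    have h1 := measureReal_weighted_pair hY hind (fun _ => 1) n hS
    have h2 := map_weighted_eq hY hlaw 1 n
    have hm := measurable_weightedSum hY (fun _ => 1) n
    simp only [one_mul, mem_ofPred_eq] at h1 h2 hm
    rw [h2, Measure.map_id'] at h1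
    simp only [Finset.sum_range_succ]
    rw [h1, pow_succ, mul_assoc]
    have := Measure.isProbabilityMeasure_map (μ := P) hm.aemeasurable
    refine (measureReal_prod_le {0} (fun _ : ℕ => V) (K ^ n) hS fun y => ?_).trans ?_
    · have hsl : ((fun u => (u, y)) ⁻¹' {p : ℝ × ℝ | u < p.1 + p.2}) = Ioi (u - y) := by
        ext z
        simp [sub_lt_iff_lt_add]
      rw [hsl, map_measureReal_apply hm measurableSet_Ioi, Finset.sum_singleton]
      exact ih (u - y)
    · rw [Finset.sum_singleton, ← measureReal_conv_Ioi]
      exact mul_le_mul_of_nonneg_left (hconv u) (by positivity)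

theorem ae_nonneg_of_hasLaw (hV : IsSubexponential V) (hlaw : ∀ i, HasLaw (Y i) V P) :
    ∀ᵐ ω ∂P, ∀ i, 0 ≤ Y i ω :=
  ae_all_iff.2 fun i => ((hlaw i).ae_iff (p := fun y => 0 ≤ y)
    (measurableSet_setOfPred.1 measurableSet_Ici)).2 hV.nonneg

/-- All weights are raised to the largest one, whose tail is among the summands; `K` depends neither
on the weights nor on `n`. -/
theorem IsSubexponential.weightedSum_tail_le [IsProbabilityMeasure P] (hV : IsSubexponential V)
    {K : ℝ} (hK : 1 ≤ K) (hconv : ∀ x, (V ∗ V).real (Ioi x) ≤ K * V.real (Ioi x))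
    (hY : ∀ i, Measurable (Y i)) (hlaw : ∀ i, HasLaw (Y i) V P) (hind : iIndepFun Y P) (n : ℕ)
    {c : ℕ → ℝ} (hc : ∀ i, 0 < c i) {x : ℝ} (hx : 0 ≤ x) :
    P.real {ω | x < ∑ i ∈ Finset.range n, c i * Y i ω} ≤
      K ^ n * ∑ i ∈ Finset.range n, V.real (Ioi (x / c i)) := by
  rcases n.eq_zero_or_pos with rfl | hn
  · simp [hx.not_gt]
  obtain ⟨m, hm, hmax⟩ := Finset.exists_max_image (Finset.range n) c
    ⟨0, Finset.mem_range.2 hn⟩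
  calc P.real {ω | x < ∑ i ∈ Finset.range n, c i * Y i ω}
      ≤ P.real {ω | x / c m < ∑ i ∈ Finset.range n, Y i ω} := by
        refine ENNReal.toReal_mono (measure_ne_top _ _) (measure_mono_ae ?_)
        filter_upwards [ae_nonneg_of_hasLaw hV hlaw] with ω hω h
        change x / c m < _
        rw [div_lt_iff₀' (hc m), Finset.mul_sum]
        exact lt_of_lt_of_le h
          (Finset.sum_le_sum fun i hi => mul_le_mul_of_nonneg_right (hmax i hi) (hω i))
    _ ≤ K ^ n * V.real (Ioi (x / c m)) := hV.sum_tail_le hK hconv hY hlaw hind n _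
    _ ≤ _ := by
        gcongr
        exact Finset.single_le_sum (f := fun i => V.real (Ioi (x / c i)))
          (fun i _ => measureReal_nonneg) hm

/-- The tail of a sum of weighted subexponential claims is asymptotically at most the sum of the
tails, uniformly in the weights. -/
theorem IsSubexponential.exists_weightedSum_tail_le [IsProbabilityMeasure P]
    (hV : IsSubexponential V) (hY : ∀ i, Measurable (Y i)) (hlaw : ∀ i, HasLaw (Y i) V P)
    (hind : iIndepFun Y P) {a b : ℝ} (ha : 0 < a) (n : ℕ) :
    ∀ ε > 0, ∃ x₀ : ℝ, ∀ x ≥ x₀, ∀ c : ℕ → ℝ, (∀ i, c i ∈ Icc a b) →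
      P.real {ω | x < ∑ i ∈ Finset.range n, c i * Y i ω} ≤
        (1 + ε) * ∑ i ∈ Finset.range n, V.real (Ioi (x / c i)) := by
  have := hV.isProbabilityMeasure
  induction n with
  | zero =>
    intro ε hε
    refine ⟨0, fun x hx c hc => ?_⟩
    simp [(show (0 : ℝ) ≤ x from hx).not_gt]
  | succ n ih =>
    intro ε hε
    -- Chosen so that `(1 + e)² + (1 + e) e = 1 + 3e + 2e² ≤ 1 + 5e ≤ 1 + ε`.
    set e := min 1 (ε / 5) with he
    have he0 : 0 < e := lt_min one_pos (by positivity)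
    have he1 : e ≤ 1 := min_le_left _ _
    have heε : e ≤ ε / 5 := min_le_right _ _
    -- The last tail `t n` occurs `n` times in the joint term, so `δ n ≤ e` is needed.
    set δ := e / (n + 1) with hδ
    have hδ0 : 0 < δ := by positivity
    obtain ⟨x₁, hx₁⟩ := ih e he0
    obtain ⟨h₀, hh₀, H⟩ := hV.exists_weighted_joint_tail_le (b := b) ha hδ0
    -- Beyond `h₀` the joint estimate holds; beyond `x₁` the induction hypothesis applies to every
    -- slice.
    set h := max h₀ x₁ with hh
    have hh0 : 0 ≤ h := hh₀.trans (le_max_left _ _)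
    obtain ⟨x₂, hx₂⟩ := H h (le_max_left _ _)
    obtain ⟨x₃, hx₃⟩ := hV.exists_weighted_tail_sub_le (b := b) ha he0 hh0
    refine ⟨max (max x₂ x₃) (x₁ + h), fun x hx c hc => ?_⟩
    have hxx2 : x₂ ≤ x := (le_max_left _ _).trans ((le_max_left _ _).trans hx)
    have hxx3 : x₃ ≤ x := (le_max_right _ _).trans ((le_max_left _ _).trans hx)
    have hxx1 : x₁ ≤ x - h := by
      have := (le_max_right _ _).trans hx
      linarith
    have hc0 : ∀ i, 0 < c i := fun i => ha.trans_le (hc i).1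
    set t : ℕ → ℝ := fun i => V.real (Ioi (x / c i)) with ht
    have ht0 : ∀ i, 0 ≤ t i := fun i => measureReal_nonneg
    set Z : Ω → ℝ := fun ω => ∑ i ∈ Finset.range n, c i * Y i ω with hZ
    set S : Set (ℝ × ℝ) := {p | h < p.1 ∧ h < p.2 ∧ x < p.1 + p.2} with hSdef
    have hS : MeasurableSet S :=
      (measurableSet_lt measurable_const measurable_fst).inter
        ((measurableSet_lt measurable_const measurable_snd).inter
          (measurableSet_lt measurable_const (measurable_fst.add measurable_snd)))
    have hZm : Measurable Z := measurable_weightedSum hY c n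
    -- For `y > h` the slice is the half-line above `max h (x - y) ≥ x₁`. There the induction
    -- hypothesis trades the partial sum for its single terms, leaving only pairs of claims.
    have hjoint : P.real {ω | (Z ω, c n * Y n ω) ∈ S} ≤
        (1 + e) * ∑ i ∈ Finset.range n, δ * (t i + t n) := by
      rw [measureReal_weighted_pair hY hind c n hS, map_weighted_eq hY hlaw]
      have := Measure.isProbabilityMeasure_map (μ := P) hZm.aemeasurable
      have (i : ℕ) : IsFiniteMeasure (V.map (c i * ·)) :=
        Measure.isFiniteMeasure_map V _
      refine (measureReal_prod_le (Finset.range n) (fun i => V.map (c i * ·)) (1 + e) hS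
        fun y => ?_).trans ?_
      · by_cases hy : h < y
        · have hsl : ((fun u => (u, y)) ⁻¹' S) = Ioi (max h (x - y)) := by
            ext z
            simp [hSdef, hy, sub_lt_iff_lt_add]
          rw [hsl, map_measureReal_apply hZm measurableSet_Ioi]
          refine (hx₁ _ ((le_max_right _ _).trans (le_max_left _ _)) c hc).trans_eq ?_
          refine congrArg _ (Finset.sum_congr rfl fun i _ => ?_)
          rw [map_measureReal_apply (measurable_const_mul _) measurableSet_Ioi]
          congr 1
          ext z
          change max h (x - y) / c i < z ↔ max h (x - y) < c i * z
          exact div_lt_iff₀' (hc0 i)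
        · have hsl : ((fun u => (u, y)) ⁻¹' S) = ∅ := by
            ext z
            simp [hSdef, hy]
          simp [hsl]
      · refine mul_le_mul_of_nonneg_left (Finset.sum_le_sum fun i _ => ?_) (by linarith)
        rw [Measure.map_prod_map V V (measurable_const_mul (c i)) (measurable_const_mul (c n)),
          map_measureReal_apply ((measurable_const_mul (c i)).prodMap (measurable_const_mul (c n)))
            hS]
        exact hx₂ x hxx2 (c i) (hc i) (c n) (hc n)
    -- If either the partial sum or the last term is at most `h`, the other one exceeds `x - h`.
    have hsplit : {ω | x < ∑ i ∈ Finset.range (n + 1), c i * Y i ω} ⊆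
        {ω | x - h < c n * Y n ω} ∪ {ω | x - h < Z ω} ∪ {ω | (Z ω, c n * Y n ω) ∈ S} := by
      intro ω hω
      rw [mem_ofPred_eq, Finset.sum_range_succ] at hω
      by_cases h1 : h < Z ω
      · by_cases h2 : h < c n * Y n ω
        · exact Or.inr ⟨h1, h2, hω⟩
        · refine Or.inl (Or.inr ?_)
          change x - h < Z ω
          linarith
      · refine Or.inl (Or.inl ?_)
        change x - h < c n * Y n ω
        linarith
    have h1 : P.real {ω | x - h < c n * Y n ω} ≤ (1 + e) * t n := by
      rw [measureReal_weighted_gt hlaw (hc0 n)]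
      exact hx₃ x hxx3 _ (hc n)
    have h2 : P.real {ω | x - h < Z ω} ≤ (1 + e) * ((1 + e) * ∑ i ∈ Finset.range n, t i) := by
      refine (hx₁ _ hxx1 c hc).trans (mul_le_mul_of_nonneg_left ?_ (by linarith))
      rw [Finset.mul_sum]
      exact Finset.sum_le_sum fun i _ => hx₃ x hxx3 _ (hc i)
    have h3 : P.real {ω | x < ∑ i ∈ Finset.range (n + 1), c i * Y i ω} ≤
        (1 + e) * t n + (1 + e) * ((1 + e) * ∑ i ∈ Finset.range n, t i) +
          (1 + e) * ∑ i ∈ Finset.range n, δ * (t i + t n) :=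
      (measureReal_mono hsplit).trans ((measureReal_union_le _ _).trans
        (add_le_add ((measureReal_union_le _ _).trans (add_le_add h1 h2)) hjoint))
    refine h3.trans ?_
    have hsum0 : 0 ≤ ∑ i ∈ Finset.range n, t i := Finset.sum_nonneg fun i _ => ht0 i
    rw [Finset.sum_range_succ, ← Finset.mul_sum, Finset.sum_add_distrib, Finset.sum_const,
      Finset.card_range, nsmul_eq_mul]
    have hδn : δ * n ≤ e := by
      rw [hδ, div_mul_eq_mul_div, div_le_iff₀ (by positivity)]
      nlinarith
    have hδe : δ ≤ e := div_le_self he0.le (by norm_cast; omega)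
    set s := ∑ i ∈ Finset.range n, t i
    have e1 : δ * (s + n * t n) ≤ e * (s + t n) := by
      have := mul_le_mul_of_nonneg_right hδn (ht0 n)
      have := mul_le_mul_of_nonneg_right hδe hsum0
      linarith
    have e2 : (1 + e) * (δ * (s + n * t n)) ≤ (1 + e) * (e * (s + t n)) :=
      mul_le_mul_of_nonneg_left e1 (by linarith)
    have e3 : (1 + e) * (1 + e) + (1 + e) * e ≤ 1 + ε := by nlinarith
    have e4 := mul_le_mul_of_nonneg_right e3 (add_nonneg hsum0 (ht0 n))
    have e5 : 0 ≤ (1 + e) * e * t n := by have := ht0 n; positivity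
    nlinarith

theorem one_sub_sum_le_prod_one_sub {p : ℕ → ℝ} (h0 : ∀ i, 0 ≤ p i) (h1 : ∀ i, p i ≤ 1) (n : ℕ) :
    1 - ∑ i ∈ Finset.range n, p i ≤ ∏ i ∈ Finset.range n, (1 - p i) := by
  induction n with
  | zero => simp
  | succ n ih =>
    have h2 : ∏ i ∈ Finset.range n, (1 - p i) ≤ 1 :=
      Finset.prod_le_one (fun i _ => sub_nonneg.2 (h1 i)) fun i _ => sub_le_self _ (h0 i)
    rw [Finset.prod_range_succ, Finset.sum_range_succ]
    nlinarith [mul_le_mul_of_nonneg_right h2 (h0 n)]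

/-- A new factor lowers the product by `p n` times the previous product, which is at least `1 - ε`.
-/
theorem prod_one_sub_le {n : ℕ} {p : ℕ → ℝ} {ε : ℝ} (h0 : ∀ i, 0 ≤ p i) (h1 : ∀ i, p i ≤ 1)
    (hε : ∑ i ∈ Finset.range n, p i ≤ ε) :
    ∏ i ∈ Finset.range n, (1 - p i) ≤ 1 - (1 - ε) * ∑ i ∈ Finset.range n, p i := by
  induction n with
  | zero => simp
  | succ n ih =>
    rw [Finset.sum_range_succ] at hε
    have hn : ∑ i ∈ Finset.range n, p i ≤ ε := by linarith [h0 n]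
    have h2 : 1 - ∑ i ∈ Finset.range n, p i ≤ ∏ i ∈ Finset.range n, (1 - p i) :=
      one_sub_sum_le_prod_one_sub h0 h1 n
    rw [Finset.prod_range_succ, Finset.sum_range_succ]
    have h3 := mul_le_mul_of_nonneg_right h2 (h0 n)
    have h4 := mul_le_mul_of_nonneg_right hn (h0 n)
    nlinarith [ih hn]

/-- The probability that some weighted claim is large is asymptotically at least the sum of the
tails, uniformly in the weights. -/
theorem IsSubexponential.exists_le_weightedMax_tail [IsProbabilityMeasure P]
    (hV : IsSubexponential V) (hY : ∀ i, Measurable (Y i)) (hlaw : ∀ i, HasLaw (Y i) V P)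
    (hind : iIndepFun Y P) {a b : ℝ} (ha : 0 < a) (n : ℕ) {ε : ℝ} (hε : 0 < ε) :
    ∃ x₀ : ℝ, ∀ x ≥ x₀, ∀ c : ℕ → ℝ, (∀ i, c i ∈ Icc a b) →
      (1 - ε) * ∑ i ∈ Finset.range n, V.real (Ioi (x / c i)) ≤
        P.real {ω | ∃ i ∈ Finset.range n, x < c i * Y i ω} := by
  have := hV.isProbabilityMeasure
  obtain ⟨z₀, hz₀⟩ := eventually_atTop.1 ((IsSubexponential.tendsto_Ioi_atTop (V := V)).eventually
    (gt_mem_nhds (show 0 < ε / (n + 1) by positivity)))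
  refine ⟨max z₀ 0 * b, fun x hx c hc => ?_⟩
  have hc0 : ∀ i, 0 < c i := fun i => ha.trans_le (hc i).1
  have hz : ∀ i, z₀ ≤ x / c i := fun i => by
    rw [le_div_iff₀ (hc0 i)]
    exact (mul_le_mul (le_max_left _ _) (hc i).2 (hc0 i).le (le_max_right _ _)).trans hx
  -- Each of the `n` tails is below `ε / (n + 1)`, since every level `x / c i` is at least `z₀`.
  have hsum : ∑ i ∈ Finset.range n, V.real (Ioi (x / c i)) ≤ ε := by
    refine (Finset.sum_le_card_nsmul _ _ (ε / (n + 1)) fun i _ => (hz₀ _ (hz i)).le).trans ?_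
    rw [Finset.card_range, nsmul_eq_mul, mul_div_assoc', div_le_iff₀ (by positivity)]
    nlinarith
  have hmeas : MeasurableSet {ω | ∃ i ∈ Finset.range n, x < c i * Y i ω} := by
    have : {ω | ∃ i ∈ Finset.range n, x < c i * Y i ω} =
        ⋃ i ∈ Finset.range n, {ω | x < c i * Y i ω} := by
      ext ω
      simp
    rw [this]
    exact Finset.measurableSet_biUnion _ fun i _ =>
      measurableSet_lt measurable_const ((hY i).const_mul _)
  have hcompl : {ω | ∃ i ∈ Finset.range n, x < c i * Y i ω}ᶜ =
      ⋂ i ∈ Finset.range n, Y i ⁻¹' (Ioi (x / c i))ᶜ := by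
    ext ω
    simp [le_div_iff₀' (hc0 _)]
  have hprod : P.real {ω | ∃ i ∈ Finset.range n, x < c i * Y i ω}ᶜ =
      ∏ i ∈ Finset.range n, (1 - V.real (Ioi (x / c i))) := by
    rw [hcompl, measureReal_def, hind.measure_inter_preimage_eq_mul (Finset.range n)
      (fun i _ => measurableSet_Ioi.compl), ENNReal.toReal_prod]
    refine Finset.prod_congr rfl fun i _ => ?_
    rw [← probReal_compl_eq_one_sub measurableSet_Ioi, ← measureReal_def, ← (hlaw i).map_eq,
      map_measureReal_apply (hY i) measurableSet_Ioi.compl]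
  rw [probReal_compl_eq_one_sub hmeas] at hprod
  have h := prod_one_sub_le (n := n) (p := fun i => V.real (Ioi (x / c i)))
    (fun i => measureReal_nonneg) (fun i => measureReal_le_one) hsum
  linarith

end WeightedSums

/-! ### Freezing one of two independent variables -/

/-- Fubini for the product law, pulled back to `Ω`; the inner integral plays the role of a
conditional expectation given `U`. -/
theorem ProbabilityTheory.IndepFun.integral_comp_prodMk {Ω E E' : Type*} [MeasurableSpace Ω]
    [mE : MeasurableSpace E] [mE' : MeasurableSpace E'] {P : Measure Ω} [IsProbabilityMeasure P]
    {U : Ω → E} {W : Ω → E'} (h : IndepFun U W P) (hU : Measurable U) (hW : Measurable W)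
    {f : E × E' → ℝ} (hf : Measurable f) {C : ℝ} (hC : ∀ z, |f z| ≤ C) :
    Integrable (fun ω => ∫ ω', f (U ω, W ω') ∂P) P ∧
      ∫ ω, f (U ω, W ω) ∂P = ∫ ω, ∫ ω', f (U ω, W ω') ∂P ∂P := by
  have := Measure.isProbabilityMeasure_map (μ := P) hU.aemeasurable
  have := Measure.isProbabilityMeasure_map (μ := P) hW.aemeasurable
  have hint : Integrable f ((P.map U).prod (P.map W)) :=
    Integrable.of_bound hf.aestronglyMeasurable C (ae_of_all _ hC)
  have hin : ∀ e, ∫ y, f (e, y) ∂(P.map W) = ∫ ω', f (e, W ω') ∂P := fun e =>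
    integral_map hW.aemeasurable (hf.comp measurable_prodMk_left).aestronglyMeasurable
  have hm : AEStronglyMeasurable (fun e => ∫ ω', f (e, W ω') ∂P) (P.map U) := by
    simp only [← hin]
    exact hint.aestronglyMeasurable.integral_prod_right'
  have hleft := hint.integral_prod_left
  simp only [hin] at hleft
  refine ⟨hleft.comp_measurable hU, ?_⟩
  rw [← integral_map (φ := U) hU.aemeasurable hm,
    ← integral_map (φ := fun ω => (U ω, W ω)) (hU.prodMk hW).aemeasurable hf.aestronglyMeasurable,
    (indepFun_iff_map_prod_eq_prod_map_map hU.aemeasurable hW.aemeasurable).1 h,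
    integral_prod _ hint]
  simp only [hin]

theorem ProbabilityTheory.IndepFun.measureReal_comp_prodMk {Ω E E' : Type*} [MeasurableSpace Ω]
    [mE : MeasurableSpace E] [mE' : MeasurableSpace E'] {P : Measure Ω} [IsProbabilityMeasure P]
    {U : Ω → E} {W : Ω → E'} (h : IndepFun U W P) (hU : Measurable U) (hW : Measurable W)
    {S : Set (E × E')} (hS : MeasurableSet S) :
    Integrable (fun ω => P.real {ω' | (U ω, W ω') ∈ S}) P ∧
      P.real {ω | (U ω, W ω) ∈ S} = ∫ ω, P.real {ω' | (U ω, W ω') ∈ S} ∂P := by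
  have h1 := h.integral_comp_prodMk hU hW (f := S.indicator 1)
    ((measurable_one (α := ℝ) (β := E × E')).indicator hS) (C := 1) fun z => by
      by_cases hz : z ∈ S <;> simp [hz]
  have h2 : ∀ ω, ∫ ω', S.indicator 1 (U ω, W ω') ∂P = P.real {ω' | (U ω, W ω') ∈ S} := fun ω =>
    integral_indicator_one (s := {ω' | (U ω, W ω') ∈ S}) (measurable_const.prodMk hW hS)
  simp only [h2] at h1
  rw [← h1.2]
  exact ⟨h1.1, (integral_indicator_one (s := {ω | (U ω, W ω) ∈ S}) (hU.prodMk hW hS)).symm⟩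

/-! ### Arrival times and their counting process -/

section Arrivals

variable {Ω : Type*} {τ : ℕ → Ω → ℝ≥0}

/-- The arrivals up to `t` form a finite initial segment of `ℕ`, so `ncard` is the true count.
Indexing from `0` makes the inequality strict. -/
theorem lt_arrivalCount_iff {ω : Ω} (hmono : StrictMono fun i => τ i ω)
    (htend : Tendsto (fun i => τ i ω) atTop atTop) (t : ℝ≥0) (i : ℕ) :
    i < arrivalCount τ t ω ↔ τ i ω ≤ t := by
  classical
  have hex : ∃ n, t < τ n ω := (htend.eventually_gt_atTop t).exists
  have hset : {i : ℕ | τ i ω ≤ t} = Iio (Nat.find hex) := by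
    ext j
    simp only [mem_ofPred_eq, mem_Iio, Nat.lt_find_iff, not_lt]
    exact ⟨fun hj m hm => (hmono.monotone hm).trans hj, fun hj => hj j le_rfl⟩
  have hcount : arrivalCount τ t ω = Nat.find hex := by
    rw [arrivalCount, hset, ← Finset.coe_Iio, Set.ncard_coe_finset, Nat.card_Iio]
  rw [hcount]
  exact (Set.ext_iff.1 hset i).symm

theorem measurable_arrivalCount [MeasurableSpace Ω] (hτ : ∀ i, Measurable (τ i)) (t : ℝ≥0) :
    Measurable (arrivalCount τ t) :=
  measurable_ncard.comp (measurable_set_iff.2 fun i =>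
    measurableSet_setOfPred.1 (measurableSet_le (hτ i) measurable_const))

/-- The arrival times, recovered from the counting process at rational times. -/
noncomputable def arrivalOfCount (τ : ℕ → Ω → ℝ≥0) (i : ℕ) (ω : Ω) : ℝ≥0 :=
  (⨅ q : ℚ≥0, if i < arrivalCount τ q ω then ((q : ℝ≥0) : ℝ≥0∞) else ∞).toNNReal

/-- Independence is assumed only for the σ-algebra of the counts. The times `τ` need not be
measurable for it, but this almost surely equal version is. -/
theorem measurable_arrivalOfCount (τ : ℕ → Ω → ℝ≥0) (i : ℕ) :
    Measurable[⨆ t, MeasurableSpace.comap (arrivalCount τ t) inferInstance]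
      (arrivalOfCount τ i) := by
  refine ENNReal.measurable_toNNReal.comp (Measurable.iInf fun q => ?_)
  refine Measurable.ite ?_ measurable_const measurable_const
  exact le_iSup (fun t => MeasurableSpace.comap (arrivalCount τ t) inferInstance) (q : ℝ≥0) _
    ⟨Ioi i, measurableSet_Ioi, rfl⟩

theorem arrivalOfCount_eq {ω : Ω} (hmono : StrictMono fun i => τ i ω)
    (htend : Tendsto (fun i => τ i ω) atTop atTop) (i : ℕ) : arrivalOfCount τ i ω = τ i ω := by
  have h : ⨅ q : ℚ≥0, (if i < arrivalCount τ q ω then ((q : ℝ≥0) : ℝ≥0∞) else ∞) = τ i ω := by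
    simp only [lt_arrivalCount_iff hmono htend]
    refine le_antisymm (ENNReal.le_of_forall_pos_le_add fun ε hε _ => ?_) (le_iInf fun q => ?_)
    · obtain ⟨q, hq, hq'⟩ := exists_rat_btwn
        (show ((τ i ω : ℝ≥0) : ℝ) < ((τ i ω + ε : ℝ≥0) : ℝ) by exact_mod_cast lt_add_of_pos_right _ hε)
      have hq0 : 0 ≤ q := by exact_mod_cast ((τ i ω).coe_nonneg.trans hq.le)
      lift q to ℚ≥0 using hq0
      refine (iInf_le _ q).trans ?_
      have h1 : τ i ω ≤ (q : ℝ≥0) := by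
        rw [← NNReal.coe_le_coe]
        exact_mod_cast hq.le
      have h2 : (q : ℝ≥0) ≤ τ i ω + ε := by
        rw [← NNReal.coe_le_coe]
        exact_mod_cast hq'.le
      rw [if_pos h1]
      exact_mod_cast h2
    · split_ifs with hq
      · exact_mod_cast hq
      · exact le_top
  rw [arrivalOfCount, h, ENNReal.toNNReal_coe]

end Arrivals

/-! ### Intensity of the arrivals of a Poisson process -/

/-- This identity turns a count weighted over `m + 1` arrivals into a probability of `m` arrivals.
-/
theorem ProbabilityTheory.succ_mul_poissonMeasure_real_singleton (r : ℝ≥0) (k : ℕ) :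
    ((k : ℝ) + 1) * (poissonMeasure r).real {k + 1} = r * (poissonMeasure r).real {k} := by
  rw [poissonMeasure_real_singleton, poissonMeasure_real_singleton, Nat.factorial_succ]
  push_cast
  field_simp
  ring

section Counting

variable {Ω : Type*} [MeasurableSpace Ω] {P : Measure Ω}
  {N : ℝ≥0 → Ω → ℕ} {r : ℝ≥0}

namespace IsPoissonProcess

theorem hasLaw_eval (hN : IsPoissonProcess r N P) (t : ℝ≥0) :
    HasLaw (N t) (poissonMeasure (r * t)) P := by
  have h := hN.law 0 t zero_le
  rw [tsub_zero] at h
  refine h.congr ?_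
  filter_upwards [hN.zero] with ω hω
  simp [hω]

theorem measureReal_eval_eq (hN : IsPoissonProcess r N P) (t : ℝ≥0) (k : ℕ) :
    P.real {ω | N t ω = k} = (poissonMeasure (r * t)).real {k} :=
  (hN.hasLaw_eval t).measureReal_eq (p := fun n => n = k) (MeasurableSet.of_discrete)

/-- Almost sure monotonicity makes the truncated subtraction harmless, and `N s` is itself an
increment because `N 0 = 0` almost surely. -/
theorem measureReal_pair [IsProbabilityMeasure P] (hN : IsPoissonProcess r N P) {s t : ℝ≥0}
    (hst : s ≤ t) {k n : ℕ} (hkn : k ≤ n) :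
    P.real {ω | N s ω = k ∧ N t ω = n} =
      (poissonMeasure (r * s)).real {k} * P.real {ω | N t ω - N s ω = n - k} := by
  have h0 : N s - N 0 =ᵐ[P] N s := by
    filter_upwards [hN.zero] with ω hω
    simp [hω]
  have hind := (hN.indep.indepFun_sub_sub (zero_le (a := s)) hst).congr h0 .rfl
  have h := hind.measure_inter_preimage_eq_mul {k} {n - k} (MeasurableSet.of_discrete)
    (MeasurableSet.of_discrete)
  have heq : P {ω | N s ω = k ∧ N t ω = n} = P (N s ⁻¹' {k} ∩ (N t - N s) ⁻¹' {n - k}) := by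
    refine measure_congr ?_
    filter_upwards [hN.mono] with ω hω
    have h1 : N s ω ≤ N t ω := hω hst
    refine propext ?_
    change (N s ω = k ∧ N t ω = n) ↔ (N s ω = k ∧ N t ω - N s ω = n - k)
    omega
  rw [← hN.measureReal_eval_eq, measureReal_def, heq, h, ENNReal.toReal_mul]
  rfl

theorem sum_measureReal_pair [IsProbabilityMeasure P] (hN : IsPoissonProcess r N P) (hNm : ∀ t, Measurable (N t))
    {s t : ℝ≥0} (hst : s ≤ t) (n : ℕ) (i : ℕ) :
    P.real {ω | i < N s ω ∧ N t ω = n} =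
      ∑ k ∈ Finset.range (n + 1), if i < k then P.real {ω | N s ω = k ∧ N t ω = n} else 0 := by
  rw [← Finset.sum_filter, ← measureReal_biUnion_finset]
  · refine measureReal_congr (eventuallyEq_set.2 ?_)
    filter_upwards [hN.mono] with ω hω
    have h1 : N s ω ≤ N t ω := hω hst
    simp only [mem_iUnion, Finset.mem_filter, Finset.mem_range, mem_ofPred_eq, exists_prop]
    constructor
    · rintro ⟨h2, h3⟩
      exact ⟨N s ω, ⟨by omega, h2⟩, rfl, h3⟩
    · rintro ⟨k, ⟨-, h2⟩, h3, h4⟩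
      exact ⟨h3 ▸ h2, h4⟩
  · intro k _ l _ hkl
    refine Set.disjoint_left.2 fun ω h h' => hkl ?_
    exact h.1.symm.trans h'.1
  · exact fun k _ => ((hNm s) (measurableSet_singleton k)).inter
      ((hNm t) (measurableSet_singleton n))

theorem sum_measureReal_eval_pair [IsProbabilityMeasure P] (hN : IsPoissonProcess r N P) (hNm : ∀ t, Measurable (N t))
    {s t : ℝ≥0} (hst : s ≤ t) (n : ℕ) :
    ∑ k ∈ Finset.range (n + 1), P.real {ω | N s ω = k ∧ N t ω = n} = P.real {ω | N t ω = n} := by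
  rw [← measureReal_biUnion_finset]
  · refine measureReal_congr (eventuallyEq_set.2 ?_)
    filter_upwards [hN.mono] with ω hω
    have h1 : N s ω ≤ N t ω := hω hst
    simp only [mem_iUnion, Finset.mem_range, mem_ofPred_eq, exists_prop]
    constructor
    · rintro ⟨k, -, -, h4⟩
      exact h4
    · exact fun h3 => ⟨N s ω, by omega, rfl, h3⟩
  · intro k _ l _ hkl
    refine Set.disjoint_left.2 fun ω h h' => hkl ?_
    exact h.1.symm.trans h'.1
  · exact fun k _ => ((hNm s) (measurableSet_singleton k)).inter
      ((hNm t) (measurableSet_singleton n))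

/-- The expected number of arrivals up to time `s` on the event of `m + 1` arrivals up to
time `t`. -/
theorem sum_measureReal_lt_eval [IsProbabilityMeasure P] (hN : IsPoissonProcess r N P) (hNm : ∀ t, Measurable (N t))
    {s t : ℝ≥0} (hst : s ≤ t) (m : ℕ) :
    ∑ i ∈ Finset.range (m + 1), P.real {ω | i < N s ω ∧ N t ω = m + 1} =
      r * s * P.real {ω | N t ω = m} := by
  have h1 : ∀ k ≤ m + 1, ∑ i ∈ Finset.range (m + 1),
      (if i < k then P.real {ω | N s ω = k ∧ N t ω = m + 1} else 0) =
        k * P.real {ω | N s ω = k ∧ N t ω = m + 1} := fun k hk => by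
    have : (Finset.range (m + 1)).filter (· < k) = Finset.range k := by
      ext j
      simp only [Finset.mem_filter, Finset.mem_range]
      omega
    rw [← Finset.sum_filter, this, Finset.sum_const, Finset.card_range, nsmul_eq_mul]
  -- Raising both counts by one leaves the increment unchanged, so only the Poisson weight at time
  -- `s` absorbs the factor `k + 1`.
  have h2 : ∀ k ∈ Finset.range (m + 1), ((k + 1 : ℕ) : ℝ) *
      P.real {ω | N s ω = k + 1 ∧ N t ω = m + 1} =
        r * s * P.real {ω | N s ω = k ∧ N t ω = m} := fun k hk => by
    have hk' : k ≤ m := Nat.lt_succ_iff.1 (Finset.mem_range.1 hk)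
    rw [hN.measureReal_pair hst hk', hN.measureReal_pair hst (Nat.add_le_add_right hk' 1),
      Nat.add_sub_add_right, ← mul_assoc, ← mul_assoc]
    have h := succ_mul_poissonMeasure_real_singleton (r * s) k
    push_cast at h ⊢
    rw [h]
  simp only [hN.sum_measureReal_pair hNm hst]
  rw [Finset.sum_comm, Finset.sum_congr rfl fun k hk =>
    h1 k (Nat.lt_succ_iff.1 (Finset.mem_range.1 hk)), Finset.sum_range_succ',
    Finset.sum_congr rfl h2, ← Finset.mul_sum, hN.sum_measureReal_eval_pair hNm hst]
  simp

end IsPoissonProcess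

/-- On the event of `m + 1` arrivals up to time `T`, the intensity of the arrivals is a multiple of
the Lebesgue measure. -/
theorem IsPoissonProcess.sum_map_arrival [IsProbabilityMeasure P] {τ : ℕ → Ω → ℝ≥0} (hτ : IsArrivalSequence τ P)
    (hN : IsPoissonProcess r (arrivalCount τ) P) (T : ℝ≥0) (m : ℕ) :
    ∑ i ∈ Finset.range (m + 1), (P.restrict {ω | arrivalCount τ T ω = m + 1}).map
        (fun ω => (τ i ω : ℝ)) =
      ENNReal.ofReal (r * P.real {ω | arrivalCount τ T ω = m}) •
        (volume : Measure ℝ).restrict (Ioc 0 T) := by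
  have hNm := measurable_arrivalCount hτ.measurable
  have hτm : ∀ i, Measurable fun ω => (τ i ω : ℝ) := fun i => (hτ.measurable i).coe_nnreal_real
  refine Measure.ext_of_Iic _ _ fun a => ?_
  -- With `m + 1` arrivals by time `T`, the arrivals `i ≤ m` occur by `T`, so `τ i ≤ a` can be
  -- tested at `min a T`. For `a ≤ 0` both sides vanish, as arrivals are positive.
  set s := min a.toNNReal T with hs
  have hsT : s ≤ T := min_le_right _ _
  have hvol : volume.restrict (Ioc (0 : ℝ) T) (Iic a) = ENNReal.ofReal s := by
    rw [Measure.restrict_apply measurableSet_Iic, inter_comm, Ioc_inter_Iic, Real.volume_Ioc,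
      sub_zero]
    rcases le_total 0 a with ha | ha
    · rw [hs, NNReal.coe_min, Real.coe_toNNReal a ha, min_comm]
    · rw [hs, Real.toNNReal_of_nonpos ha, ENNReal.ofReal_of_nonpos ((min_le_right _ _).trans ha)]
      simp
  have hterm : ∀ i ∈ Finset.range (m + 1),
      (P.restrict {ω | arrivalCount τ T ω = m + 1}).map (fun ω => (τ i ω : ℝ)) (Iic a) =
        ENNReal.ofReal (P.real {ω | i < arrivalCount τ s ω ∧ arrivalCount τ T ω = m + 1}) := by
    intro i hi
    rw [Measure.map_apply (hτm i) measurableSet_Iic,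
      Measure.restrict_apply (hτm i measurableSet_Iic), ofReal_measureReal]
    refine measure_congr ?_
    filter_upwards [hτ.pos, hτ.strictMono, hτ.tendsto] with ω h0 h1 h2
    refine propext ?_
    change ((τ i ω : ℝ) ≤ a ∧ arrivalCount τ T ω = m + 1) ↔
      (i < arrivalCount τ s ω ∧ arrivalCount τ T ω = m + 1)
    refine and_congr_left fun hT => ?_
    have hiT : τ i ω ≤ T := by
      rw [← lt_arrivalCount_iff h1 h2, hT]
      exact Finset.mem_range.1 hi
    have hpos : 0 < τ i ω := h0.trans_le (h1.monotone (Nat.zero_le i))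
    rw [lt_arrivalCount_iff h1 h2, hs, le_min_iff, and_iff_left hiT]
    rcases le_total 0 a with ha | ha
    · rw [Real.le_toNNReal_iff_coe_le ha]
    · rw [Real.toNNReal_of_nonpos ha]
      refine iff_of_false (fun h => ?_) hpos.not_ge
      exact (NNReal.coe_pos.2 hpos).not_ge (h.trans ha)
  rw [Measure.finsetSum_apply, Finset.sum_congr rfl hterm, Measure.smul_apply, hvol, smul_eq_mul,
    ← ENNReal.ofReal_sum_of_nonneg fun i _ => measureReal_nonneg,
    hN.sum_measureReal_lt_eval hNm hsT, ← ENNReal.ofReal_mul (by positivity)]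
  congr 1
  ring

theorem IsPoissonProcess.sum_integral_arrival [IsProbabilityMeasure P] {τ : ℕ → Ω → ℝ≥0} (hτ : IsArrivalSequence τ P)
    (hN : IsPoissonProcess r (arrivalCount τ) P) (T : ℝ≥0) (m : ℕ) {f : ℝ → ℝ}
    (hf : Measurable f) {C : ℝ} (hC : ∀ t, |f t| ≤ C) :
    ∑ i ∈ Finset.range (m + 1), ∫ ω in {ω | arrivalCount τ T ω = m + 1}, f (τ i ω) ∂P =
      r * P.real {ω | arrivalCount τ T ω = m} * ∫ t in (0 : ℝ)..T, f t := by
  have hτm : ∀ i, Measurable fun ω => (τ i ω : ℝ) := fun i => (hτ.measurable i).coe_nnreal_real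
  have h := congrArg (fun μ => ∫ t, f t ∂μ) (hN.sum_map_arrival hτ T m)
  simp only [integral_smul_measure] at h
  rw [integral_finsetSum_measure, ENNReal.toReal_ofReal (by positivity), smul_eq_mul] at h
  · rw [intervalIntegral.integral_of_le T.coe_nonneg, ← h]
    exact Finset.sum_congr rfl fun i _ =>
      (integral_map (hτm i).aemeasurable hf.aestronglyMeasurable).symm
  · intro i _
    exact Integrable.of_bound hf.aestronglyMeasurable C (ae_of_all _ hC)

end Counting

/-! ### Claim vectors and conditioning on arrivals and prices -/

section Claims

variable {d : ℕ} {Ω : Type*} [MeasurableSpace Ω] {P : Measure Ω}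
  {A : Set (Fin d → ℝ)} {F : Measure (Fin d → ℝ)} {X : ℕ → Ω → Fin d → ℝ}

theorem IsRiskSet.hasLaw_riskFunctional {X₀ : Ω → Fin d → ℝ} (hA : IsRiskSet A)
    (hlaw : HasLaw X₀ F P) :
    HasLaw (fun ω => riskFunctional A (X₀ ω)) (F.map (riskFunctional A)) P :=
  HasLaw.fun_comp ⟨hA.measurable_riskFunctional.aemeasurable, rfl⟩ hlaw

/-- One `K` for all `n`, all levels and all positive weights: this supplies the dominating series.
-/
theorem IsRiskSet.exists_mem_tail_le [IsProbabilityMeasure P] (hA : IsRiskSet A) (hF : IsSubexponentialOn A F)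
    (hXm : ∀ i, Measurable (X i)) (hlaw : ∀ i, HasLaw (X i) F P) (hind : iIndepFun X P) :
    ∃ K : ℝ, 1 ≤ K ∧ ∀ n : ℕ, ∀ x > 0, ∀ c : ℕ → ℝ, (∀ i, 0 < c i) →
      P.real {ω | ∑ i ∈ Finset.range n, c i • X i ω ∈ x • A} ≤
        K ^ n * ∑ i ∈ Finset.range n, (F.map (riskFunctional A)).real (Ioi (x / c i)) := by
  have hV : IsSubexponential (F.map (riskFunctional A)) := hF
  obtain ⟨K, hK, hconv⟩ := hV.exists_conv_le
  refine ⟨K, hK, fun n x hx c hc => ?_⟩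
  refine le_trans (measureReal_mono fun ω hω => ?_) (hV.weightedSum_tail_le hK hconv
    (fun i => hA.measurable_riskFunctional.comp (hXm i))
    (fun i => hA.hasLaw_riskFunctional (hlaw i))
    (hind.comp (fun _ => riskFunctional A) fun _ => hA.measurable_riskFunctional) n hc hx.le)
  refine ((hA.mem_smul_iff hx _).1 hω).trans_le ((hA.riskFunctional_sum_le _ _).trans_eq ?_)
  exact Finset.sum_congr rfl fun i _ => hA.riskFunctional_smul (hc i).le _

theorem IsRiskSet.eventually_mem_tail_bounds [IsProbabilityMeasure P] (hA : IsRiskSet A) (hF : IsSubexponentialOn A F)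
    (hF_nonneg : ∀ᵐ x ∂F, 0 ≤ x)
    (hXm : ∀ i, Measurable (X i)) (hlaw : ∀ i, HasLaw (X i) F P) (hind : iIndepFun X P)
    {a b : ℝ} (ha : 0 < a) (n : ℕ) {ε : ℝ} (hε : 0 < ε) :
    ∀ᶠ x in atTop, ∀ c : ℕ → ℝ, (∀ i, c i ∈ Icc a b) →
      (1 - ε) * ∑ i ∈ Finset.range n, (F.map (riskFunctional A)).real (Ioi (x / c i)) ≤
          P.real {ω | ∑ i ∈ Finset.range n, c i • X i ω ∈ x • A} ∧
        P.real {ω | ∑ i ∈ Finset.range n, c i • X i ω ∈ x • A} ≤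
          (1 + ε) * ∑ i ∈ Finset.range n, (F.map (riskFunctional A)).real (Ioi (x / c i)) := by
  have hV : IsSubexponential (F.map (riskFunctional A)) := hF
  have hY : ∀ i, Measurable fun ω => riskFunctional A (X i ω) :=
    fun i => hA.measurable_riskFunctional.comp (hXm i)
  have hYlaw := fun i => hA.hasLaw_riskFunctional (hlaw i)
  have hYind : iIndepFun (fun i ω => riskFunctional A (X i ω)) P :=
    hind.comp (fun _ => riskFunctional A) fun _ => hA.measurable_riskFunctional
  obtain ⟨x₁, hx₁⟩ := hV.exists_weightedSum_tail_le hY hYlaw hYind (b := b) ha n ε hε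
  obtain ⟨x₂, hx₂⟩ := hV.exists_le_weightedMax_tail hY hYlaw hYind (b := b) ha n hε
  have hX0 : ∀ᵐ ω ∂P, ∀ i, 0 ≤ X i ω := ae_all_iff.2 fun i =>
    ((hlaw i).ae_iff (p := fun y => 0 ≤ y) (measurableSet_setOfPred.1 measurableSet_Ici)).2
      hF_nonneg
  filter_upwards [eventually_ge_atTop x₁, eventually_ge_atTop x₂, eventually_gt_atTop 0] with
    x h1 h2 hx c hc
  have hc0 : ∀ i, 0 ≤ c i := fun i => ha.le.trans (hc i).1
  refine ⟨(hx₂ x h2 c hc).trans ?_, le_trans (measureReal_mono fun ω hω => ?_) (hx₁ x h1 c hc)⟩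
  · refine ENNReal.toReal_mono (measure_ne_top _ _) (measure_mono_ae ?_)
    filter_upwards [hX0] with ω hω h
    obtain ⟨i, hi, hxi⟩ := h
    refine (hA.mem_smul_iff hx _).2 (hxi.trans_le ?_)
    rw [← hA.riskFunctional_smul (hc0 i)]
    -- A single weighted claim is below the whole sum, since all claims are nonnegative.
    exact hA.riskFunctional_mono (Finset.single_le_sum (f := fun i => c i • X i ω)
      (fun j _ => smul_nonneg (hc0 j) (hω j)) hi)
  · refine ((hA.mem_smul_iff hx _).1 hω).trans_le ((hA.riskFunctional_sum_le _ _).trans_eq ?_)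
    exact Finset.sum_congr rfl fun i _ => hA.riskFunctional_smul (hc0 i) _

theorem measurable_measureReal_Ioi (V : Measure ℝ) [IsFiniteMeasure V] :
    Measurable fun y => V.real (Ioi y) :=
  Antitone.measurable fun _ _ h => measureReal_mono (Ioi_subset_Ioi h)

variable {E : Type*} [mE : MeasurableSpace E] {M : Ω → ℕ} {τ : ℕ → Ω → ℝ≥0} {G : Ω → E}
  {W : ℝ≥0 × E → ℝ}

/-- The probability of ruin with exactly `n` claims is the integral of the ruin probabilities with
deterministic discount factors. -/
theorem IsRiskSet.measureReal_claims_eq [IsProbabilityMeasure P] (hA : IsRiskSet A) (hXm : ∀ i, Measurable (X i))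
    (hM : Measurable M) (hτ : ∀ i, Measurable (τ i)) (hG : Measurable G) (hW : Measurable W)
    (hind : IndepFun (fun ω => ((M ω, fun i => τ i ω), G ω)) (fun ω i => X i ω) P) (n : ℕ)
    {x : ℝ} (hx : 0 < x) :
    Integrable (fun ω => P.real {ω' | M ω = n ∧
        ∑ i ∈ Finset.range n, W (τ i ω, G ω) • X i ω' ∈ x • A}) P ∧
      P.real {ω | M ω = n ∧ ∑ i ∈ Finset.range n, W (τ i ω, G ω) • X i ω ∈ x • A} =
        ∫ ω, P.real {ω' | M ω = n ∧
          ∑ i ∈ Finset.range n, W (τ i ω, G ω) • X i ω' ∈ x • A} ∂P := by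
  have hS : MeasurableSet {z : ((ℕ × (ℕ → ℝ≥0)) × E) × (ℕ → Fin d → ℝ) | z.1.1.1 = n ∧
      ∑ i ∈ Finset.range n, W (z.1.1.2 i, z.1.2) • z.2 i ∈ x • A} := by
    refine MeasurableSet.inter ?_ ?_
    · exact (measurable_fst.comp (measurable_fst.comp measurable_fst)) (measurableSet_singleton n)
    · have hm : Measurable fun z : ((ℕ × (ℕ → ℝ≥0)) × E) × (ℕ → Fin d → ℝ) =>
          ∑ i ∈ Finset.range n, W (z.1.1.2 i, z.1.2) • z.2 i := by
        fun_prop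
      exact hm (hA.isOpen.smul₀ hx.ne').measurableSet
  exact hind.measureReal_comp_prodMk (by fun_prop) (by fun_prop) hS

theorem measurable_expectedTail [IsProbabilityMeasure P] {V : Measure ℝ} [IsProbabilityMeasure V]
    (hG : Measurable G) (hW : Measurable W) (x : ℝ) :
    Measurable fun t : ℝ => ∫ ω, V.real (Ioi (x / W (t.toNNReal, G ω))) ∂P := by
  have h : Measurable fun p : ℝ × Ω => V.real (Ioi (x / W (p.1.toNNReal, G p.2))) :=
    (measurable_measureReal_Ioi V).comp (measurable_const.div (hW.comp
      ((measurable_real_toNNReal.comp measurable_fst).prodMk (hG.comp measurable_snd))))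
  exact h.stronglyMeasurable.integral_prod_right'.measurable

theorem abs_expectedTail_le_one {E : Type*} {G : Ω → E} {W : ℝ≥0 × E → ℝ}
    [IsProbabilityMeasure P] {V : Measure ℝ} [IsProbabilityMeasure V]
    (x t : ℝ) : |∫ ω, V.real (Ioi (x / W (t.toNNReal, G ω))) ∂P| ≤ 1 := by
  have h := norm_integral_le_of_norm_le_const (μ := P) (C := 1)
    (f := fun ω => V.real (Ioi (x / W (t.toNNReal, G ω)))) (ae_of_all _ fun ω => by
      rw [Real.norm_of_nonneg measureReal_nonneg]
      exact measureReal_le_one)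
  simpa using h

/-- The expected sum of the tails of the discounted claims, on the event of `m + 1` claims. -/
theorem integral_sum_tail_eq [IsProbabilityMeasure P] {V : Measure ℝ} [IsProbabilityMeasure V] {r T : ℝ≥0}
    (hM : Measurable M) (hτ : ∀ i, Measurable (τ i)) (hG : Measurable G) (hW : Measurable W)
    (hind : IndepFun (fun ω => (M ω, fun i => τ i ω)) G P)
    (hint : ∀ (m : ℕ) (f : ℝ → ℝ), Measurable f → (∀ t, |f t| ≤ 1) →
      ∑ i ∈ Finset.range (m + 1), ∫ ω in {ω | M ω = m + 1}, f (τ i ω) ∂P =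
        r * P.real {ω | M ω = m} * ∫ t in (0 : ℝ)..T, f t) (m : ℕ) (x : ℝ) :
    ∫ ω in {ω | M ω = m + 1},
        ∑ i ∈ Finset.range (m + 1), V.real (Ioi (x / W (τ i ω, G ω))) ∂P =
      r * P.real {ω | M ω = m} *
        ∫ t in (0 : ℝ)..T, ∫ ω, V.real (Ioi (x / W (t.toNNReal, G ω))) ∂P := by
  have hv := measurable_measureReal_Ioi V
  have hv1 : ∀ y, |V.real (Ioi y)| ≤ 1 := fun y => by
    rw [abs_of_nonneg measureReal_nonneg]
    exact measureReal_le_one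
  have hφ : Measurable fun p : ℝ≥0 × E => V.real (Ioi (x / W p)) :=
    hv.comp (measurable_const.div hW)
  have hMn : MeasurableSet {ω | M ω = m + 1} := hM (measurableSet_singleton _)
  have hΦ := measurable_expectedTail (V := V) (P := P) hG hW x
  have hΦ1 := abs_expectedTail_le_one (V := V) (P := P) (W := W) (G := G) x
  -- The arrival formula is applied to the tail already averaged over `G`; independence of `G` and
  -- the arrivals then identifies the terms one by one.
  rw [← hint m _ hΦ hΦ1, integral_finsetSum]
  · refine Finset.sum_congr rfl fun i _ => ?_
    rw [← integral_indicator hMn, ← integral_indicator hMn]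
    have hf : Measurable fun z : (ℕ × (ℕ → ℝ≥0)) × E =>
        ({k | k = m + 1} : Set ℕ).indicator 1 z.1.1 * V.real (Ioi (x / W (z.1.2 i, z.2))) := by
      refine Measurable.mul ?_ (hφ.comp (by fun_prop))
      exact (Measurable.of_discrete (f := ({k | k = m + 1} : Set ℕ).indicator (1 : ℕ → ℝ))).comp
        (measurable_fst.comp measurable_fst)
    have h := (hind.integral_comp_prodMk (by fun_prop) hG hf (C := 1) fun z => by
      rw [abs_mul]
      refine mul_le_one₀ ?_ (abs_nonneg _) (hv1 _)
      by_cases hz : z.1.1 = m + 1 <;> simp [hz]).2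
    simp only [integral_const_mul] at h
    convert h using 2
    · ext ω
      by_cases hω : M ω = m + 1 <;> simp [hω]
    · ext ω
      by_cases hω : M ω = m + 1 <;> simp [hω]
  · intro i _
    refine Integrable.of_bound (C := 1) ?_ (ae_of_all _ fun ω => hv1 _)
    exact (hφ.comp ((hτ i).prodMk hG)).aestronglyMeasurable

/-- The integrand is at least the tail at `x / a`; positivity permits division by this integral. -/
theorem integral_expectedTail_pos [IsProbabilityMeasure P] {V : Measure ℝ}
    (hV : IsSubexponential V) {T : ℝ≥0} (hT : 0 < T) (hG : Measurable G) (hW : Measurable W)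
    {a : ℝ} (ha : 0 < a) (haW : ∀ p, a ≤ W p) {x : ℝ} (hx : 0 ≤ x) :
    0 < ∫ t in (0 : ℝ)..T, ∫ ω, V.real (Ioi (x / W (t.toNNReal, G ω))) ∂P := by
  have := hV.isProbabilityMeasure
  have hT' : (0 : ℝ) < T := hT
  refine intervalIntegral.intervalIntegral_pos_of_pos_on ?_ (fun t _ => ?_) hT'
  · rw [intervalIntegrable_iff_integrableOn_Ioc_of_le hT'.le]
    exact Integrable.of_bound (C := 1) (measurable_expectedTail hG hW x).aestronglyMeasurable
      (ae_of_all _ fun t => abs_expectedTail_le_one x t)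
  · refine (hV.measureReal_Ioi_pos (x / a)).trans_le ?_
    have h : ∫ _ω, V.real (Ioi (x / a)) ∂P = V.real (Ioi (x / a)) := by simp
    rw [← h]
    refine integral_mono (integrable_const _) (Integrable.of_bound (C := 1) ?_
      (ae_of_all _ fun ω => ?_)) fun ω => measureReal_mono (Ioi_subset_Ioi ?_)
    · exact ((measurable_measureReal_Ioi V).comp (measurable_const.div
        (hW.comp (measurable_const.prodMk hG)))).aestronglyMeasurable
    · rw [Real.norm_of_nonneg measureReal_nonneg]
      exact measureReal_le_one
    · exact div_le_div_of_nonneg_left hx ha (haW _)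

end Claims

/-! ### Summation over the number of claims -/

section Asymptotics

variable {d : ℕ} {Ω : Type*} [MeasurableSpace Ω] {P : Measure Ω} [IsProbabilityMeasure P]
  {A : Set (Fin d → ℝ)} {F : Measure (Fin d → ℝ)} {X : ℕ → Ω → Fin d → ℝ}
  {E : Type*} [mE : MeasurableSpace E] {M : Ω → ℕ} {τ : ℕ → Ω → ℝ≥0} {G : Ω → E}
  {W : ℝ≥0 × E → ℝ}

theorem integrable_indicator_sum_tail {V : Measure ℝ} [IsProbabilityMeasure V]
    (hM : Measurable M) (hτ : ∀ i, Measurable (τ i)) (hG : Measurable G) (hW : Measurable W)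
    (n : ℕ) (x : ℝ) :
    Integrable ({ω | M ω = n}.indicator fun ω =>
      ∑ i ∈ Finset.range n, V.real (Ioi (x / W (τ i ω, G ω)))) P := by
  refine Integrable.indicator (integrable_finsetSum _ fun i _ => ?_) (hM (measurableSet_singleton n))
  refine Integrable.of_bound (C := 1) ?_ (ae_of_all _ fun ω => ?_)
  · exact ((measurable_measureReal_Ioi V).comp (measurable_const.div
      (hW.comp ((hτ i).prodMk hG)))).aestronglyMeasurable
  · rw [Real.norm_of_nonneg measureReal_nonneg]
    exact measureReal_le_one

theorem IsRiskSet.measureReal_claims_le (hA : IsRiskSet A) {V : Measure ℝ}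
    [IsProbabilityMeasure V] (hXm : ∀ i, Measurable (X i))
    (hM : Measurable M) (hτ : ∀ i, Measurable (τ i)) (hG : Measurable G) (hW : Measurable W)
    (hind : IndepFun (fun ω => ((M ω, fun i => τ i ω), G ω)) (fun ω i => X i ω) P) (n : ℕ)
    {x : ℝ} (hx : 0 < x) {a b : ℝ} (hab : ∀ p, W p ∈ Icc a b) {κ : ℝ}
    (h : ∀ c : ℕ → ℝ, (∀ i, c i ∈ Icc a b) →
      P.real {ω | ∑ i ∈ Finset.range n, c i • X i ω ∈ x • A} ≤
        κ * ∑ i ∈ Finset.range n, V.real (Ioi (x / c i))) :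
    P.real {ω | M ω = n ∧ ∑ i ∈ Finset.range n, W (τ i ω, G ω) • X i ω ∈ x • A} ≤
      κ * ∫ ω in {ω | M ω = n}, ∑ i ∈ Finset.range n, V.real (Ioi (x / W (τ i ω, G ω))) ∂P := by
  obtain ⟨hint, heq⟩ := hA.measureReal_claims_eq hXm hM hτ hG hW hind n hx
  have hMn : MeasurableSet {ω | M ω = n} := hM (measurableSet_singleton n)
  rw [heq, ← integral_indicator hMn, ← integral_const_mul]
  refine integral_mono hint ((integrable_indicator_sum_tail hM hτ hG hW n x).const_mul κ)
    fun ω => ?_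
  by_cases hω : M ω = n
  · simpa [hω] using h _ fun i => hab (τ i ω, G ω)
  · simp [hω]

theorem IsRiskSet.le_measureReal_claims (hA : IsRiskSet A) {V : Measure ℝ}
    [IsProbabilityMeasure V] (hXm : ∀ i, Measurable (X i))
    (hM : Measurable M) (hτ : ∀ i, Measurable (τ i)) (hG : Measurable G) (hW : Measurable W)
    (hind : IndepFun (fun ω => ((M ω, fun i => τ i ω), G ω)) (fun ω i => X i ω) P) (n : ℕ)
    {x : ℝ} (hx : 0 < x) {a b : ℝ} (hab : ∀ p, W p ∈ Icc a b) {κ : ℝ}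
    (h : ∀ c : ℕ → ℝ, (∀ i, c i ∈ Icc a b) →
      κ * ∑ i ∈ Finset.range n, V.real (Ioi (x / c i)) ≤
        P.real {ω | ∑ i ∈ Finset.range n, c i • X i ω ∈ x • A}) :
    κ * ∫ ω in {ω | M ω = n}, ∑ i ∈ Finset.range n, V.real (Ioi (x / W (τ i ω, G ω))) ∂P ≤
      P.real {ω | M ω = n ∧ ∑ i ∈ Finset.range n, W (τ i ω, G ω) • X i ω ∈ x • A} := by
  obtain ⟨hint, heq⟩ := hA.measureReal_claims_eq hXm hM hτ hG hW hind n hx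
  have hMn : MeasurableSet {ω | M ω = n} := hM (measurableSet_singleton n)
  rw [heq, ← integral_indicator hMn, ← integral_const_mul]
  refine integral_mono ((integrable_indicator_sum_tail hM hτ hG hW n x).const_mul κ) hint
    fun ω => ?_
  by_cases hω : M ω = n
  · simpa [hω] using h _ fun i => hab (τ i ω, G ω)
  · simp [hω]

/-- The Poisson law has finite exponential moments of every order. -/
theorem summable_pow_mul_poissonMeasure (s : ℝ≥0) (K : ℝ) :
    Summable fun m : ℕ => K ^ (m + 1) * (poissonMeasure s).real {m} := by
  have h := (Real.summable_pow_div_factorial (K * s)).mul_left (K * Real.exp (-s))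
  refine h.congr fun m => ?_
  rw [poissonMeasure_real_singleton, mul_pow, pow_succ]
  ring

theorem hasSum_measureReal_inter_eq {Ω : Type*} [MeasurableSpace Ω] {P : Measure Ω}
    [IsFiniteMeasure P] {M : Ω → ℕ} (hM : Measurable M) {s : ℕ → Set Ω}
    (hs : ∀ n, MeasurableSet (s n)) :
    HasSum (fun n => P.real {ω | M ω = n ∧ ω ∈ s n}) (P.real {ω | ω ∈ s (M ω)}) := by
  have heq : {ω | ω ∈ s (M ω)} = ⋃ n, {ω | M ω = n ∧ ω ∈ s n} := by
    ext ω
    simp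
  have h := measure_iUnion (μ := P) (f := fun n => {ω | M ω = n ∧ ω ∈ s n})
    (fun k l hkl => Set.disjoint_left.2 fun ω h h' => hkl (h.1.symm.trans h'.1))
    fun n => (hM (measurableSet_singleton n)).inter (hs n)
  rw [heq, measureReal_def, h, ENNReal.tsum_toReal_eq fun n => measure_ne_top _ _]
  exact (ENNReal.summable_toReal (h ▸ measure_ne_top _ _)).hasSum

/-- Asymptotics of the ruin probability for random discount factors in a compact subset of
`(0, ∞)`, which are functions of the arrival times and of an independent random element. -/
theorem IsRiskSet.tendsto_claims_div (hA : IsRiskSet A) (hF : IsSubexponentialOn A F)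
    (hF_nonneg : ∀ᵐ x ∂F, 0 ≤ x)
    (hXm : ∀ i, Measurable (X i)) (hlaw : ∀ i, HasLaw (X i) F P) (hX : iIndepFun X P)
    {r T : ℝ≥0} (hr : 0 < r) (hT : 0 < T)
    (hM : Measurable M) (hτ : ∀ i, Measurable (τ i)) (hG : Measurable G) (hW : Measurable W)
    (hind : IndepFun (fun ω => ((M ω, fun i => τ i ω), G ω)) (fun ω i => X i ω) P)
    (hind' : IndepFun (fun ω => (M ω, fun i => τ i ω)) G P)
    (hlawM : ∀ m, P.real {ω | M ω = m} = (poissonMeasure (r * T)).real {m})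
    (hint : ∀ (m : ℕ) (f : ℝ → ℝ), Measurable f → (∀ t, |f t| ≤ 1) →
      ∑ i ∈ Finset.range (m + 1), ∫ ω in {ω | M ω = m + 1}, f (τ i ω) ∂P =
        r * P.real {ω | M ω = m} * ∫ t in (0 : ℝ)..T, f t)
    {a b : ℝ} (ha : 0 < a) (hab : ∀ p, W p ∈ Icc a b) :
    Tendsto (fun x : ℝ =>
      P.real {ω | ∑ i ∈ Finset.range (M ω), W (τ i ω, G ω) • X i ω ∈ x • A} /
        (r * ∫ t in (0 : ℝ)..T,
          ∫ ω, (F.map (riskFunctional A)).real (Ioi (x / W (t.toNNReal, G ω))) ∂P))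
      atTop (𝓝 1) := by
  have hV : IsSubexponential (F.map (riskFunctional A)) := hF
  have := hV.isProbabilityMeasure
  set V := F.map (riskFunctional A)
  set D : ℝ → ℝ := fun x => r * ∫ t in (0 : ℝ)..T,
    ∫ ω, V.real (Ioi (x / W (t.toNNReal, G ω))) ∂P with hD
  have hr' : (0 : ℝ) < r := hr
  have hDpos : ∀ x > 0, 0 < D x := fun x hx =>
    mul_pos hr' (integral_expectedTail_pos hV hT hG hW ha (fun p => (hab p).1) hx.le)
  set p : ℕ → ℝ := fun m => (poissonMeasure (r * T)).real {m} with hp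
  have hp0 : ∀ m, 0 ≤ p m := fun m => measureReal_nonneg
  set q : ℝ → ℕ → ℝ := fun x n =>
    P.real {ω | M ω = n ∧ ∑ i ∈ Finset.range n, W (τ i ω, G ω) • X i ω ∈ x • A} with hq
  have hJ : ∀ (m : ℕ) (x : ℝ), ∫ ω in {ω | M ω = m + 1},
      ∑ i ∈ Finset.range (m + 1), V.real (Ioi (x / W (τ i ω, G ω))) ∂P = p m * D x :=
    fun m x => by
      rw [integral_sum_tail_eq hM hτ hG hW hind' hint m x, hlawM m]
      simp only [hD, hp]
      ring
  obtain ⟨K, hK, hcrude⟩ := hA.exists_mem_tail_le hF hXm hlaw hX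
  -- The crude bound with no claims has an empty sum on the right; hence the series may start at `m
  -- + 1`.
  have hq0 : ∀ x > 0, q x 0 = 0 := fun x hx => by
    have h := hA.measureReal_claims_le (V := V) hXm hM hτ hG hW hind 0 hx hab (κ := K ^ 0)
      fun c hc => hcrude 0 x hx c fun i => ha.trans_le (hc i).1
    simp only [Finset.range_zero, Finset.sum_empty, integral_zero, mul_zero] at h
    refine le_antisymm ?_ measureReal_nonneg
    simpa only [hq, Finset.range_zero, Finset.sum_empty] using h
  have hqK : ∀ x > 0, ∀ m, q x (m + 1) / D x ≤ K ^ (m + 1) * p m := fun x hx m => by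
    rw [div_le_iff₀ (hDpos x hx), mul_assoc, ← hJ]
    exact hA.measureReal_claims_le hXm hM hτ hG hW hind (m + 1) hx hab
      fun c hc => hcrude (m + 1) x hx c fun i => ha.trans_le (hc i).1
  have hsum : ∀ x > 0, HasSum (fun m => q x (m + 1) / D x)
      (P.real {ω | ∑ i ∈ Finset.range (M ω), W (τ i ω, G ω) • X i ω ∈ x • A} / D x) := by
    intro x hx
    have h := hasSum_measureReal_inter_eq (P := P) hM
      (s := fun n => {ω | ∑ i ∈ Finset.range n, W (τ i ω, G ω) • X i ω ∈ x • A}) fun n => by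
        have hm : Measurable fun ω => ∑ i ∈ Finset.range n, W (τ i ω, G ω) • X i ω := by
          fun_prop
        exact hm (hA.isOpen.smul₀ hx.ne').measurableSet
    change HasSum (q x) _ at h
    rw [← hasSum_nat_add_iff' 1] at h
    simp only [Finset.sum_range_one, hq0 x hx, sub_zero] at h
    exact h.div_const _
  -- The uniform two-sided bounds integrate to `(1 ± ε) p m` times the denominator.
  have hlim : ∀ m, Tendsto (fun x => q x (m + 1) / D x) atTop (𝓝 (p m)) := by
    intro m
    refine tendsto_order.2 ⟨fun y hy => ?_, fun y hy => ?_⟩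
    · obtain ⟨ε, hε, hεy⟩ : ∃ ε > 0, y < (1 - ε) * p m := by
        have h : Tendsto (fun ε : ℝ => (1 - ε) * p m) (𝓝[>] 0) (𝓝 ((1 - 0) * p m)) :=
          ((Continuous.tendsto (by fun_prop) 0).mono_left nhdsWithin_le_nhds)
        rw [sub_zero, one_mul] at h
        obtain ⟨ε, h1, h2⟩ := ((h.eventually (lt_mem_nhds hy)).and self_mem_nhdsWithin).exists
        exact ⟨ε, h2, h1⟩
      filter_upwards [hA.eventually_mem_tail_bounds hF hF_nonneg hXm hlaw hX (b := b) ha (m + 1) hε,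
        eventually_gt_atTop 0] with x hx hx0
      refine hεy.trans_le ?_
      rw [le_div_iff₀ (hDpos x hx0), mul_assoc, ← hJ]
      exact hA.le_measureReal_claims hXm hM hτ hG hW hind (m + 1) hx0 hab fun c hc => (hx c hc).1
    · obtain ⟨ε, hε, hεy⟩ : ∃ ε > 0, (1 + ε) * p m < y := by
        have h : Tendsto (fun ε : ℝ => (1 + ε) * p m) (𝓝[>] 0) (𝓝 ((1 + 0) * p m)) :=
          ((Continuous.tendsto (by fun_prop) 0).mono_left nhdsWithin_le_nhds)
        rw [add_zero, one_mul] at h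
        obtain ⟨ε, h1, h2⟩ := ((h.eventually (gt_mem_nhds hy)).and self_mem_nhdsWithin).exists
        exact ⟨ε, h2, h1⟩
      filter_upwards [hA.eventually_mem_tail_bounds hF hF_nonneg hXm hlaw hX (b := b) ha (m + 1) hε,
        eventually_gt_atTop 0] with x hx hx0
      refine lt_of_le_of_lt ?_ hεy
      rw [div_le_iff₀ (hDpos x hx0), mul_assoc, ← hJ]
      exact hA.measureReal_claims_le hXm hM hτ hG hW hind (m + 1) hx0 hab fun c hc => (hx c hc).2
  have hmain : Tendsto (fun x => ∑' m, q x (m + 1) / D x) atTop (𝓝 (∑' m, p m)) := by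
    refine tendsto_tsum_of_dominated_convergence
      (summable_pow_mul_poissonMeasure (r * T) K) hlim ?_
    filter_upwards [eventually_gt_atTop 0] with x hx m
    rw [Real.norm_of_nonneg (div_nonneg measureReal_nonneg (hDpos x hx).le)]
    exact hqK x hx m
  have hp1 : ∑' m, p m = 1 := by
    simp only [hp, poissonMeasure_real_singleton]
    exact (hasSum_one_poissonMeasure (r * T)).tsum_eq
  rw [hp1] at hmain
  refine hmain.congr' ?_
  filter_upwards [eventually_gt_atTop 0] with x hx
  exact (hsum x hx).tsum_eq

end Asymptotics

/-! ### Independence of σ-algebras and the final reduction -/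

section Independence

variable {Ω : Type*} {d : ℕ} {mΩ : MeasurableSpace Ω} {P : Measure Ω}

theorem ProbabilityTheory.Indep.indepFun_of_measurable {α β : Type*} {mα : MeasurableSpace α}
    {mβ : MeasurableSpace β} {m₁ m₂ : MeasurableSpace Ω} (h : Indep m₁ m₂ P) {f : Ω → α}
    {g : Ω → β} (hf : Measurable[m₁] f) (hg : Measurable[m₂] g) : IndepFun f g P :=
  (IndepFun_iff_Indep _ _ _).2
    (indep_of_indep_of_le_left (indep_of_indep_of_le_right h hg.comap_le) hf.comap_le)

theorem ProbabilityTheory.iIndep.indep_sup_of_three {m₀ m₁ m₂ : MeasurableSpace Ω}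
    (h : iIndep ![m₀, m₁, m₂] P) (h₀ : m₀ ≤ mΩ) (h₁ : m₁ ≤ mΩ) (h₂ : m₂ ≤ mΩ) :
    Indep (m₁ ⊔ m₂) m₀ P := by
  have hle : ∀ i, (![m₀, m₁, m₂] : Fin 3 → MeasurableSpace Ω) i ≤ mΩ := by
    intro i
    fin_cases i <;> assumption
  have h' := indep_iSup_of_disjoint hle h (S := {1, 2}) (T := {0}) (by simp)
  rwa [iSup_pair, iSup_singleton] at h'

end Independence

/-- The σ-algebra generated by the counting process. -/
noncomputable abbrev countSigma {Ω : Type*} (τ : ℕ → Ω → ℝ≥0) : MeasurableSpace Ω :=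
  ⨆ t, MeasurableSpace.comap (arrivalCount τ t) inferInstance

/-- The σ-algebra generated by the claims. -/
noncomputable abbrev claimSigma {Ω : Type*} {d : ℕ} (X : ℕ → Ω → Fin d → ℝ) : MeasurableSpace Ω :=
  ⨆ i, MeasurableSpace.comap (X i) inferInstance

theorem mainTheorem1 {d : ℕ} {Ω : Type*} (𝓖 : MeasurableSpace Ω) [mΩ : MeasurableSpace Ω]
    (P : Measure Ω) [IsProbabilityMeasure P]
    (A : Set (Fin d → ℝ)) (hA : IsRiskSet A)
    -- the claims: i.i.d. nonnegative random vectors with law `F ∈ 𝒮_A`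
    (F : Measure (Fin d → ℝ)) (hF_nonneg : ∀ᵐ x ∂F, 0 ≤ x) (hF : IsSubexponentialOn A F)
    (X : ℕ → Ω → Fin d → ℝ) (hX_meas : ∀ i, Measurable (X i))
    (hX_law : ∀ i, HasLaw (X i) F P) (hX_indep : iIndepFun X P)
    -- the arrival times, whose counting process is Poisson with rate `r`
    (r : ℝ≥0) (hr : 0 < r) (τ : ℕ → Ω → ℝ≥0) (hτ : IsArrivalSequence τ P)
    (hN : IsPoissonProcess r (arrivalCount τ) P)
    -- the log-price process, carried by the σ-algebra `𝓖`
    (h𝓖 : 𝓖 ≤ mΩ) (R : ℝ≥0 → Ω → ℝ) (hR_meas : IsMeasurableProcess 𝓖 R)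
    -- mutual independence of claims, counting process and price process
    (h_indep : iIndep ![⨆ i, MeasurableSpace.comap (X i) inferInstance,
      ⨆ t, MeasurableSpace.comap (arrivalCount τ t) inferInstance, 𝓖] P)
    -- the log-price process is bounded on `[0, T]` by deterministic constants
    (T : ℝ≥0) (hT : 0 < T)
    (hR_bdd : ∃ C₁ C₂ : ℝ, ∀ᵐ ω ∂P, ∀ t ≤ T, -C₁ ≤ R t ω ∧ R t ω ≤ C₂)
    -- a generic claim, independent of the price process
    (X₀ : Ω → Fin d → ℝ) (hX₀_meas : Measurable X₀) (hX₀_law : HasLaw X₀ F P)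
    (hX₀_indep : Indep (MeasurableSpace.comap X₀ inferInstance) 𝓖 P) :
    Tendsto (fun x : ℝ =>
      P.real {ω | discountedClaims X τ R T ω ∈ x • A} /
        (r * ∫ t in (0 : ℝ)..T,
          P.real {ω | Real.exp (-R t.toNNReal ω) • X₀ ω ∈ x • A}))
      atTop (𝓝 1) := by
  obtain ⟨C₁, C₂, hC⟩ := hR_bdd
  have hV : IsSubexponential (F.map (riskFunctional A)) := hF
  have := hV.isProbabilityMeasure
  have hmX_le : claimSigma X ≤ mΩ := iSup_le fun i => (hX_meas i).comap_le
  have hmN_le : countSigma τ ≤ mΩ :=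
    iSup_le fun t => (measurable_arrivalCount hτ.measurable t).comap_le
  have hM : Measurable (arrivalCount τ T) := measurable_arrivalCount hτ.measurable T
  have hM' : Measurable[countSigma τ] (arrivalCount τ T) := fun s hs =>
    le_iSup (fun t => MeasurableSpace.comap (arrivalCount τ t) inferInstance) T _ ⟨s, hs, rfl⟩
  have hX' : Measurable[claimSigma X] (fun ω i => X i ω) := by
    refine (@measurable_pi_iff Ω _ _ (claimSigma X) _ _).2 fun i s hs => ?_
    exact le_iSup (fun i => MeasurableSpace.comap (X i) inferInstance) i _ ⟨s, hs, rfl⟩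
  have hU' : Measurable[countSigma τ] (fun ω => (arrivalCount τ T ω, fun i => arrivalOfCount τ i ω)) :=
    hM'.prodMk ((@measurable_pi_iff Ω _ _ (countSigma τ) _ _).2 fun i => measurable_arrivalOfCount τ i)
  have hU_ae : (fun ω => (arrivalCount τ T ω, fun i => arrivalOfCount τ i ω)) =ᵐ[P]
      fun ω => (arrivalCount τ T ω, fun i => τ i ω) := by
    filter_upwards [hτ.strictMono, hτ.tendsto] with ω h1 h2
    simp only [arrivalOfCount_eq h1 h2]
  -- The random element carrying the prices is the identity of `Ω`, with `𝓖` on the target.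
  have hG : Measurable[mΩ, 𝓖] (fun ω : Ω => ω) := measurable_id.mono h𝓖 le_rfl
  have hind' : @IndepFun Ω _ Ω mΩ inferInstance 𝓖
      (fun ω => (arrivalCount τ T ω, fun i => τ i ω)) (fun ω => ω) P :=
    IndepFun.congr ((h_indep.indep (i := 1) (j := 2) (by decide)).indepFun_of_measurable
      (m₁ := countSigma τ) (m₂ := 𝓖) (mβ := 𝓖) hU' (@measurable_id Ω 𝓖)) hU_ae .rfl
  have hind : @IndepFun Ω _ _ mΩ (@Prod.instMeasurableSpace _ Ω inferInstance 𝓖) inferInstance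
      (fun ω => ((arrivalCount τ T ω, fun i => τ i ω), ω)) (fun ω i => X i ω) P := by
    have h1 := h_indep.indep_sup_of_three hmX_le hmN_le h𝓖
    have h2 : @Measurable Ω _ (countSigma τ ⊔ 𝓖) (@Prod.instMeasurableSpace _ Ω inferInstance 𝓖)
        (fun ω => ((arrivalCount τ T ω, fun i => arrivalOfCount τ i ω), ω)) :=
      Measurable.prodMk (hU'.mono le_sup_left le_rfl)
        ((@measurable_id Ω 𝓖).mono le_sup_right le_rfl)
    refine IndepFun.congr (h1.indepFun_of_measurable h2 hX') ?_ .rfl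
    filter_upwards [hU_ae] with ω hω
    rw [hω]
  -- Clamping `R` makes the weights bounded everywhere, without changing them almost surely on `[0,
  -- T]`. The `max` in the lower bound of `hWab` avoids assuming `-C₁ ≤ C₂`.
  set W : ℝ≥0 × Ω → ℝ := fun p => Real.exp (-(max (-C₁) (min C₂ (R p.1 p.2)))) with hWdef
  have hW : Measurable[MeasurableSpace.prod inferInstance 𝓖] W :=
    Real.measurable_exp.comp (measurable_const.max (measurable_const.min hR_meas)).neg
  have hW_eq : ∀ᵐ ω ∂P, ∀ t ≤ T, W (t, ω) = Real.exp (-R t ω) := by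
    filter_upwards [hC] with ω hω t ht
    simp only [hWdef]
    rw [min_eq_right (hω t ht).2, max_eq_right (hω t ht).1]
  have hWab : ∀ p, W p ∈ Icc (Real.exp (-(max (-C₁) C₂))) (Real.exp C₁) := fun p => by
    refine ⟨Real.exp_le_exp.2 (neg_le_neg (max_le_max le_rfl (min_le_left _ _))),
      Real.exp_le_exp.2 ?_⟩
    rw [neg_le]
    exact le_max_left _ _
  have hmain := hA.tendsto_claims_div (mE := 𝓖) (G := fun ω : Ω => ω) hF hF_nonneg hX_meas hX_law
    hX_indep hr hT hM hτ.measurable hG hW hind hind' (fun m => hN.measureReal_eval_eq T m)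
    (fun m f hf hf1 => hN.sum_integral_arrival hτ T m hf hf1) (Real.exp_pos _) hWab
  refine hmain.congr' ?_
  filter_upwards [eventually_gt_atTop 0] with x hx
  have hxA : MeasurableSet (x • A) := (hA.isOpen.smul₀ hx.ne').measurableSet
  congr 1
  · refine measureReal_congr (eventuallyEq_set.2 ?_)
    filter_upwards [hW_eq, hτ.strictMono, hτ.tendsto] with ω hω h1 h2
    have hsum : ∑ i ∈ Finset.range (arrivalCount τ T ω), W (τ i ω, ω) • X i ω =
        discountedClaims X τ R T ω :=
      Finset.sum_congr rfl fun i hi => by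
        rw [hω _ ((lt_arrivalCount_iff h1 h2 T i).1 (Finset.mem_range.1 hi))]
    simp only [hsum]
  · congr 1
    refine intervalIntegral.integral_congr fun t ht => ?_
    rw [uIcc_of_le T.coe_nonneg] at ht
    have htT : t.toNNReal ≤ T := Real.toNNReal_le_iff_le_coe.2 ht.2
    have hWt : Measurable[𝓖] fun ω => W (t.toNNReal, ω) :=
      hW.comp (@measurable_prodMk_left _ _ _ 𝓖 t.toNNReal)
    -- For fixed `t` the weight is frozen, and the integrand of the theorem becomes the expected
    -- tail at `x / W`.
    have hindt : IndepFun (fun ω => W (t.toNNReal, ω)) X₀ P :=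
      hX₀_indep.symm.indepFun_of_measurable hWt (comap_measurable X₀)
    have hS : MeasurableSet {z : ℝ × (Fin d → ℝ) | z.1 • z.2 ∈ x • A} :=
      (measurable_fst.smul measurable_snd) hxA
    have h1 := (hindt.measureReal_comp_prodMk (hWt.mono h𝓖 le_rfl) hX₀_meas hS).2
    have h2 : P.real {ω | Real.exp (-R t.toNNReal ω) • X₀ ω ∈ x • A} =
        P.real {ω | W (t.toNNReal, ω) • X₀ ω ∈ x • A} := by
      refine measureReal_congr (eventuallyEq_set.2 ?_)
      filter_upwards [hW_eq] with ω hω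
      simp only [hω _ htT]
    rw [h2]
    refine Eq.trans (integral_congr_ae (ae_of_all _ fun ω => ?_)) h1.symm
    have hpos : 0 < W (t.toNNReal, ω) := Real.exp_pos _
    have h3 := (hA.hasLaw_riskFunctional hX₀_law).measureReal_eq
      (p := fun y => x / W (t.toNNReal, ω) < y) measurableSet_Ioi
    refine Eq.trans h3.symm (congrArg _ ?_)
    ext ω'
    simp only [mem_ofPred_eq]
    rw [hA.mem_smul_iff hx, hA.riskFunctional_smul hpos.le, div_lt_iff₀' hpos]
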